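/- For integers $k_1<\dots<k_m$ ($m\ge 0$), let $\alpha_m(k_1,\dots,k_m)$ be the number of monotone triangles of order $m$ with bottom row $(k_1,\dots,k_m)$, i.e. of triangular integer arrays $(t_{a,b})_{1\le b\le a\le m}$ with strictly increasing rows, with $t_{a,b}\le t_{a-1,b}\le t_{a,b+1}$ for $2\le a\le m$, $1\le b\le a-1$, and with $t_{m,b}=k_b$ for all $b$ (so $\alpha_0()=1$). Put $$A_n=\alpha_n(1,\dots,n),\qquad A_{n,k}=\alpha_{n-1}(1,\dots,\hat k,\dots,n)\ \ (1\le k\le n),\qquad A_{n,i,j}=\alpha_{n-2}(1,\dots,\hat i,\dots,\hat j,\dots,n)\ \ (1\le i<j\le n),$$ where a hat means that the entry is omitted, and $A_{n,k}=0$ if $k\notin[1,n]$. Let $$X_n(s,t)=\frac{1}{A_{n-1}}\Big(A_{n-1,t}\,(A_{n,s+1}-A_{n,s})-A_{n-1,s}\,(A_{n,t+1}-A_{n,t})\Big).$$ Then for all integers $1\le i<j\le n$, $$A_{n,i,j}=\sum_{p=0}^{n-j}\sum_{q=0}^{p}(-1)^q\binom pq X_n(i+q,\,j+p).$$ Moreover,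 for every $k$ with $i\le k\le j$, the number $A_{n,i,j}$ is equal to the number of alternating sign matrices of order $n$ (the $n\times n$ matrices with entries in $\{-1,0,1\}$ such that in each row and each column the entries sum to $1$ and the nonzero entries alternate in sign) whose first row is $e_k$ and whose second row is $e_i+e_j-e_k$, where $e_m$ denotes the row vector of length $n$ with a $1$ in position $m$ and $0$ elsewhere. -/

import Mathlib

/-- A triangular array `t` with `n` rows (row `i`, counted from `0`, has `i + 1` entries) is a
monotone triangle of order `n`: rows are strictly increasing, and consecutive rows interlace
weakly. -/
def IsMonotoneTriangle {n : ℕ} (t : (i : Fin n) → Fin (i.val + 1) → ℤ) : Prop :=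
  (∀ i : Fin n, StrictMono (t i)) ∧
  ∀ (i : ℕ) (hi : i + 1 < n) (j : Fin (i + 1)),
    t ⟨i + 1, hi⟩ j.castSucc ≤ t ⟨i, Nat.lt_of_succ_lt hi⟩ j ∧
      t ⟨i, Nat.lt_of_succ_lt hi⟩ j ≤ t ⟨i + 1, hi⟩ j.succ

/-- The last row of the triangular array `t` is `k` (no condition if `n = 0`). -/
def HasBottomRow {n : ℕ} (t : (i : Fin n) → Fin (i.val + 1) → ℤ) (k : Fin n → ℤ) : Prop :=
  ∀ (i : Fin n) (h : i.val + 1 = n) (j : Fin (i.val + 1)), t i j = k (Fin.cast h j)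

/-- `α_n(k_1, …, k_n)`: the number of monotone triangles of order `n` with bottom row `k`. -/
noncomputable def monotoneTriangleCount (n : ℕ) (k : Fin n → ℤ) : ℕ :=
  Nat.card {t : (i : Fin n) → Fin (i.val + 1) → ℤ // IsMonotoneTriangle t ∧ HasBottomRow t k}

/-- The number of monotone triangles whose bottom row lists the elements of the finite set `S`
in increasing order. -/
noncomputable def monotoneTriangleCountOfSet (S : Finset ℤ) : ℕ :=
  monotoneTriangleCount S.card (S.orderEmbOfFin rfl)

/-- `A_n = α_n(1, …, n)`. -/
noncomputable def asmNumber (n : ℕ) : ℕ :=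
  monotoneTriangleCountOfSet (Finset.Icc 1 (n : ℤ))

/-- `A_{n,k}`: bottom row `(1, …, n)` with `k` omitted, and `0` if `k` is not in `[1, n]`. -/
noncomputable def refinedAsmNumber (n k : ℕ) : ℕ :=
  if 1 ≤ k ∧ k ≤ n then monotoneTriangleCountOfSet ((Finset.Icc 1 (n : ℤ)).erase (k : ℤ)) else 0

/-- `A_{n,i,j}` for `1 ≤ i < j ≤ n`: bottom row `(1, …, n)` with `i` and `j` omitted. -/
noncomputable def doublyRefinedAsmNumber (n i j : ℕ) : ℕ :=
  monotoneTriangleCountOfSet (((Finset.Icc 1 (n : ℤ)).erase (i : ℤ)).erase (j : ℤ))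

/-- `X_n(s, t)`, for `n ≥ 1`. -/
noncomputable def asmX (n s t : ℕ) : ℚ :=
  (1 / (asmNumber (n - 1) : ℚ)) *
    ((refinedAsmNumber (n - 1) t : ℚ) *
        ((refinedAsmNumber n (s + 1) : ℚ) - (refinedAsmNumber n s : ℚ)) -
      (refinedAsmNumber (n - 1) s : ℚ) *
        ((refinedAsmNumber n (t + 1) : ℚ) - (refinedAsmNumber n t : ℚ)))

/-- The vector `v` has entries in `{-1, 0, 1}` with sum `1`, and its nonzero entries alternate in
sign. -/
def IsAlternatingSignVector {n : ℕ} (v : Fin n → ℤ) : Prop :=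
  (∀ a, v a = -1 ∨ v a = 0 ∨ v a = 1) ∧ ∑ a, v a = 1 ∧
  ∀ a b : Fin n, a < b → v a ≠ 0 → v b ≠ 0 → (∀ c, a < c → c < b → v c = 0) → v a = -v b

/-- Alternating sign matrices of order `n`. -/
def IsAlternatingSignMatrix {n : ℕ} (M : Matrix (Fin n) (Fin n) ℤ) : Prop :=
  (∀ r, IsAlternatingSignVector fun c => M r c) ∧ ∀ c, IsAlternatingSignVector fun r => M r c

/-- The vector of length `n` with a `1` in position `k` (positions are `1, …, n`) and `0`
elsewhere. -/
def unitRow (n k : ℕ) : Fin n → ℤ := fun c => if c.val + 1 = k then 1 else 0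

/-- The number of alternating sign matrices of order `n ≥ 2` with first row `u` and second
row `v`. -/
noncomputable def asmCountTopTwoRows (n : ℕ) (u v : Fin n → ℤ) : ℕ :=
  Nat.card {M : Matrix (Fin n) (Fin n) ℤ // IsAlternatingSignMatrix M ∧
    (∀ r : Fin n, r.val = 0 → ∀ c, M r c = u c) ∧ ∀ r : Fin n, r.val = 1 → ∀ c, M r c = v c}

/-!
Both kinds of objects are chains of `0`-`1` vectors. A strictly increasing row of a monotone
triangle is the set of columns it occupies, and two consecutive rows interlace exactly when the
difference of their indicator vectors is an alternating sign vector
(`rowStep_iff_interlace`). Reading the indicator vectors as partial column sums of a matrix turns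
chains into the lower rows of alternating sign matrices (`isPartialASM_cons`). Hence prescribing
the first two rows `e_k` and `e_i + e_j - e_k` leaves exactly the chains that start at the
indicator vector of `{1, …, n} \ {i, j}`, whatever `k` is. This gives the second half of the
theorem (`asmCountTopTwoRows_eq`, `doublyRefinedAsmNumber_eq_chainNumber`).

For the formula, chains are counted with the weights of the six-vertex model at `Δ = 1/2`, which
all become `1` at a homogeneous point. Let `Z` be the partition function with domain wall
boundary. The argument has four ingredients.

* The Yang–Baxter equation makes `Z` symmetric in the row parameters (`partition_swap`), and
  where a weight vanishes, the first column freezes and `Z` reduces to the next smaller size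
  (`partition_freeze_bottom`, `partition_freeze_top`).
* At `Δ = 1/2` the weights are built from a quadratic form with a rotation of order three. After
  multiplication by linear factors, the sum of `Z` over the three rotations of one row parameter
  vanishes (`dressed_three_term`): as a polynomial in a column parameter the sum has too many
  zeros, namely the points where freezing reduces it to the smaller size.
* A polynomial with such a three-term relation, of bounded degree and with a zero of high order
  at the homogeneous point, is zero (`eq_zero_of_three_term`). In the coordinate that
  diagonalises the rotation it has few terms, and a nonzero polynomial with at most `k` terms is
  not divisible by `(X - 1) ^ k`. Thus the solutions are determined by two coefficients, which
  expresses the partition function with two free row parameters through the generating function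
  of the numbers `A_{n,k}` for the sizes `n` and `n - 1` (`twoPoint_eq`).
* Summing over the two rows with free parameters directly (`twoRowSum_false_false`) expresses the
  same function through the numbers `A_{n,i,j}`. Comparison of coefficients yields
  `X_n(s, r) = A_{n,s,r} - A_{n,s,r+1} + A_{n,s+1,r+1}` for `s < r`
  (`doublyRefinedCount_recursion`), and the double sum of the theorem is the inversion of this
  recursion (`sum_choose_eq`).
-/

section

open Finset

/-! ### The six-vertex model and the Yang–Baxter equation -/

/-- The bracket `x₁ y₂ - x₂ y₁` of two spectral parameters. -/
def bracket (x y : ℝ × ℝ) : ℝ := x.1 * y.2 - x.2 * y.1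

/-- The rotation `(u, v) ↦ (v, -u - v)` of order three, an isometry of `normForm`. -/
def rot (x : ℝ × ℝ) : ℝ × ℝ := (x.2, -x.1 - x.2)

/-- The weight of a vertex all of whose four edges are in the same state. A spectral parameter is
a vector of the plane, meaningful up to scaling, so that all weights are polynomials. -/
def weightA (x y : ℝ × ℝ) : ℝ := x.1 * y.1 + x.2 * (y.1 + y.2)

/-- The weight of a vertex that a path crosses straight on, either vertically or horizontally. -/
def weightB (x y : ℝ × ℝ) : ℝ := x.1 * (y.1 + y.2) + x.2 * y.2

/-- The quadratic form `u² + u v + v²`, which is invariant under `rot`. -/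
def normForm (x : ℝ × ℝ) : ℝ := x.1 ^ 2 + x.1 * x.2 + x.2 ^ 2

/-- The weight of a vertex with row parameter `x` and column parameter `y`. The four states are
those of the left, the lower, the right and the upper edge, in this order; paths enter from the
left or from below and leave to the right or upwards. The product of the two turning weights is
fixed by the Yang–Baxter equation; it is distributed so that all weights are polynomials. -/
def vertexWeight (x y : ℝ × ℝ) : Bool → Bool → Bool → Bool → ℝ
  | false, false, false, false => weightA x y
  | true, true, true, true => weightA x y
  | false, true, false, true => weightB x y
  | true, false, true, false => weightB x y
  | false, true, true, false => 1
  | true, false, false, true => normForm x * normForm y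
  | _, _, _, _ => 0

/-- The weight of a row with parameter `x`, with states `h` and `k` of the left and the right
boundary edge, and with the states `s` and `t` of the vertical edges below and above the row. -/
def rowWeight (x : ℝ × ℝ) : {n : ℕ} → (Fin n → ℝ × ℝ) → Bool → Bool →
    (Fin n → Bool) → (Fin n → Bool) → ℝ
  | 0, _, h, k, _, _ => if h = k then 1 else 0
  | _ + 1, ys, h, k, s, t =>
      ∑ m, vertexWeight x (ys 0) h (s 0) m (t 0) *
        rowWeight x (Fin.tail ys) m k (Fin.tail s) (Fin.tail t)

/-- The weight of the crossing of two rows with parameters `x` and `y` in the Yang–Baxter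
equation; the arguments are the states of the two edges on the left and the two on the right. -/
def crossWeight (x y : ℝ × ℝ) : Bool → Bool → Bool → Bool → ℝ
  | false, false, false, false => -bracket x (rot y)
  | true, true, true, true => -bracket x (rot y)
  | false, true, false, true => bracket x y
  | true, false, true, false => bracket x y
  | false, true, true, false => normForm y
  | true, false, false, true => normForm x
  | _, _, _, _ => 0

theorem sum_state_succ {n : ℕ} {M : Type*} [AddCommMonoid M] (f : (Fin (n + 1) → Bool) → M) :
    ∑ s, f s = ∑ b, ∑ s : Fin n → Bool, f (Fin.cons b s) := by
  rw [← Fintype.sum_prod_type' (fun b s => f (Fin.cons b s))]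
  exact (Equiv.sum_comp (Fin.consEquiv fun _ => Bool) f).symm

/-- The Yang–Baxter equation for a single column: the crossing of two rows can be moved from the
left to the right of the column, which exchanges the rows. -/
theorem local_yangBaxter (x z y : ℝ × ℝ) (h₁ h₂ k₁ k₂ s t : Bool) :
    ∑ m₁, ∑ m₂, crossWeight x z h₁ h₂ m₁ m₂ *
        ∑ r, vertexWeight x y m₁ s k₁ r * vertexWeight z y m₂ r k₂ t =
      ∑ m₁, ∑ m₂, (∑ r, vertexWeight z y h₂ s m₂ r * vertexWeight x y h₁ r m₁ t) *
        crossWeight x z m₁ m₂ k₁ k₂ := by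
  cases h₁ <;> cases h₂ <;> cases k₁ <;> cases k₂ <;> cases s <;> cases t <;>
    simp only [Fintype.sum_bool, crossWeight, vertexWeight, zero_mul, mul_zero, add_zero,
      zero_add, mul_one, one_mul] <;>
    simp only [bracket, rot, weightA, weightB, normForm] <;> ring

theorem rowWeight_yangBaxter (x z : ℝ × ℝ) {n : ℕ} (ys : Fin n → ℝ × ℝ) (h₁ h₂ k₁ k₂ : Bool)
    (s t : Fin n → Bool) :
    ∑ m₁, ∑ m₂, crossWeight x z h₁ h₂ m₁ m₂ *
        ∑ r, rowWeight x ys m₁ k₁ s r * rowWeight z ys m₂ k₂ r t =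
      ∑ m₁, ∑ m₂, (∑ r, rowWeight z ys h₂ m₂ s r * rowWeight x ys h₁ m₁ r t) *
        crossWeight x z m₁ m₂ k₁ k₂ := by
  induction n generalizing h₁ h₂ with
  | zero =>
    cases h₁ <;> cases h₂ <;> cases k₁ <;> cases k₂ <;> simp [rowWeight]
  | succ n ih =>
    -- `V`, `V'` are the weights of the first column and `W`, `W'` those of the remaining columns
    -- for the two orders of the rows; the crossing passes the former by `local_yangBaxter`
    -- and the latter by induction
    set y := ys 0
    set V : Bool → Bool → Bool → Bool → ℝ := fun a b c d =>
      ∑ r, vertexWeight x y a (s 0) c r * vertexWeight z y b r d (t 0) with hV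
    set V' : Bool → Bool → Bool → Bool → ℝ := fun a b c d =>
      ∑ r, vertexWeight z y b (s 0) d r * vertexWeight x y a r c (t 0) with hV'
    set W : Bool → Bool → Bool → Bool → ℝ := fun a b c d =>
      ∑ r, rowWeight x (Fin.tail ys) a c (Fin.tail s) r *
        rowWeight z (Fin.tail ys) b d r (Fin.tail t) with hW
    set W' : Bool → Bool → Bool → Bool → ℝ := fun a b c d =>
      ∑ r, rowWeight z (Fin.tail ys) b d (Fin.tail s) r *
        rowWeight x (Fin.tail ys) a c r (Fin.tail t) with hW'
    have e1 : ∀ a b c d, ∑ r, rowWeight x ys a c s r * rowWeight z ys b d r t =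
        ∑ p, ∑ q, V a b p q * W p q c d := by
      intro a b c d
      rw [sum_state_succ]
      simp only [rowWeight, Fin.cons_zero, Fin.tail_cons, hV, hW, Fintype.sum_bool,
        Finset.sum_add_distrib, Finset.mul_sum, add_mul, mul_add]
      simp only [← Finset.sum_add_distrib]
      refine Finset.sum_congr rfl fun r _ => ?_
      ring
    have e2 : ∀ a b c d, ∑ r, rowWeight z ys b d s r * rowWeight x ys a c r t =
        ∑ p, ∑ q, V' a b p q * W' p q c d := by
      intro a b c d
      rw [sum_state_succ]
      simp only [rowWeight, Fin.cons_zero, Fin.tail_cons, hV', hW', Fintype.sum_bool,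
        Finset.sum_add_distrib, Finset.mul_sum, add_mul, mul_add]
      simp only [← Finset.sum_add_distrib]
      refine Finset.sum_congr rfl fun r _ => ?_
      ring
    have loc : ∀ p q, ∑ m₁, ∑ m₂, crossWeight x z h₁ h₂ m₁ m₂ * V m₁ m₂ p q =
        ∑ m₁, ∑ m₂, V' h₁ h₂ m₁ m₂ * crossWeight x z m₁ m₂ p q := by
      intro p q
      exact local_yangBaxter x z y h₁ h₂ p q (s 0) (t 0)
    have glob : ∀ p q, ∑ m₁, ∑ m₂, crossWeight x z p q m₁ m₂ * W m₁ m₂ k₁ k₂ =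
        ∑ m₁, ∑ m₂, W' p q m₁ m₂ * crossWeight x z m₁ m₂ k₁ k₂ := by
      intro p q
      exact ih (Fin.tail ys) p q (Fin.tail s) (Fin.tail t)
    simp only [e1, e2]
    clear_value V V' W W'
    clear e1 e2 ih
    simp only [Fintype.sum_bool] at loc glob ⊢
    have l1 := loc true true
    have l2 := loc true false
    have l3 := loc false true
    have l4 := loc false false
    have g1 := glob true true
    have g2 := glob true false
    have g3 := glob false true
    have g4 := glob false false
    linear_combination W true true k₁ k₂ * l1 + W true false k₁ k₂ * l2 +
      W false true k₁ k₂ * l3 + W false false k₁ k₂ * l4 + V' h₁ h₂ true true * g1 +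
      V' h₁ h₂ true false * g2 + V' h₁ h₂ false true * g3 + V' h₁ h₂ false false * g4

/-- The partition function of the rows with parameters `xs`, listed from the bottom to the top, with
column parameters `ys`. The left boundary edges are empty, the right ones are occupied, the
vertical edges at the top are empty, and `s` is the state of those at the bottom. -/
def partition {n : ℕ} (ys : Fin n → ℝ × ℝ) : List (ℝ × ℝ) → (Fin n → Bool) → ℝ
  | [], s => if s = fun _ => false then 1 else 0
  | x :: xs, s => ∑ t, rowWeight x ys false true s t * partition ys xs t

/-- Rows with empty left and occupied right boundary commute: for these boundary states, the
crossing has the same nonzero weight on both sides. -/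
theorem rowWeight_comm {x z : ℝ × ℝ} (h : bracket x (rot z) ≠ 0) {n : ℕ} (ys : Fin n → ℝ × ℝ)
    (s t : Fin n → Bool) :
    ∑ r, rowWeight x ys false true s r * rowWeight z ys false true r t =
      ∑ r, rowWeight z ys false true s r * rowWeight x ys false true r t := by
  have := rowWeight_yangBaxter x z ys false false true true s t
  simp only [crossWeight, Fintype.sum_bool, zero_mul, mul_zero, add_zero, zero_add] at this
  rw [mul_comm] at this
  exact mul_right_cancel₀ (neg_ne_zero.2 h) this

theorem partition_swap {x z : ℝ × ℝ} (h : bracket x (rot z) ≠ 0) {n : ℕ} (ys : Fin n → ℝ × ℝ)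
    (xs : List (ℝ × ℝ)) (s : Fin n → Bool) :
    partition ys (x :: z :: xs) s = partition ys (z :: x :: xs) s := by
  have key : ∀ x z : ℝ × ℝ, partition ys (x :: z :: xs) s = ∑ t,
      (∑ r, rowWeight x ys false true s r * rowWeight z ys false true r t) *
        partition ys xs t := by
    intro x z
    simp only [partition, Finset.mul_sum, Finset.sum_mul]
    rw [Finset.sum_comm]
    exact sum_congr rfl fun _ _ => sum_congr rfl fun _ _ => by ring
  rw [key, key]
  simp only [rowWeight_comm h]

theorem partition_congr_tail {n : ℕ} {ys : Fin n → ℝ × ℝ} {xs xs' : List (ℝ × ℝ)}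
    (h : ∀ s, partition ys xs s = partition ys xs' s) (x : ℝ × ℝ) (s : Fin n → Bool) :
    partition ys (x :: xs) s = partition ys (x :: xs') s := by
  simp only [partition, h]

theorem partition_move_front {n : ℕ} (ys : Fin n → ℝ × ℝ) {z : ℝ × ℝ} (l₁ l₂ : List (ℝ × ℝ))
    (h : ∀ x ∈ l₁, bracket z (rot x) ≠ 0) (s : Fin n → Bool) :
    partition ys (l₁ ++ z :: l₂) s = partition ys (z :: (l₁ ++ l₂)) s := by
  induction l₁ generalizing s with
  | nil => rfl
  | cons x l ih =>
    rw [List.cons_append, partition_congr_tail (ih fun w hw => h w (by simp [hw])),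
      ← partition_swap (h x (by simp))]
    rfl

theorem partition_move_end {n : ℕ} (ys : Fin n → ℝ × ℝ) {z : ℝ × ℝ} (l₁ l₂ : List (ℝ × ℝ))
    (h : ∀ x ∈ l₂, bracket z (rot x) ≠ 0) (s : Fin n → Bool) :
    partition ys (l₁ ++ z :: l₂) s = partition ys (l₁ ++ l₂ ++ [z]) s := by
  induction l₁ generalizing s with
  | nil =>
    have := partition_move_front ys l₂ [] h s
    simpa using this.symm
  | cons x l ih => exact partition_congr_tail ih x s

/-! ### Freezing of the first column -/

theorem cons_const {n : ℕ} (b : Bool) :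
    (fun _ : Fin (n + 1) => b) = Fin.cons b (fun _ : Fin n => b) := by
  funext i
  refine Fin.cases rfl (fun _ => rfl) i

theorem tail_const {n : ℕ} (b : Bool) :
    Fin.tail (fun _ : Fin (n + 1) => b) = fun _ => b := rfl

theorem cons_eq_const {n : ℕ} (b c : Bool) (s : Fin n → Bool) :
    (Fin.cons b s : Fin (n + 1) → Bool) = (fun _ => c) ↔ b = c ∧ s = fun _ => c := by
  rw [cons_const, Fin.cons_inj]

/-- If the first column is empty at the bottom, then it stays empty, since no path can enter it
from the left. -/
theorem partition_cons_false {n : ℕ} (ys : Fin (n + 1) → ℝ × ℝ) (xs : List (ℝ × ℝ))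
    (s : Fin n → Bool) :
    partition ys xs (Fin.cons false s) =
      (xs.map fun x => weightA x (ys 0)).prod * partition (Fin.tail ys) xs s := by
  induction xs generalizing s with
  | nil =>
    simp [partition, cons_eq_const]
  | cons x xs ih =>
    simp only [partition, sum_state_succ, rowWeight, Fin.cons_zero, Fin.tail_cons,
      Fintype.sum_bool, vertexWeight, ih, zero_mul, zero_add, Finset.sum_const_zero,
      List.map_cons, List.prod_cons, Finset.mul_sum]
    exact sum_congr rfl fun _ _ => by ring

/-- The path that starts in the first column either goes straight up at the bottom row, or turns
right there and leaves the first column empty. -/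
theorem partition_cons_true {n : ℕ} (ys : Fin (n + 1) → ℝ × ℝ) (x : ℝ × ℝ) (xs : List (ℝ × ℝ))
    (s : Fin n → Bool) :
    partition ys (x :: xs) (Fin.cons true s) =
      weightB x (ys 0) * ∑ t, rowWeight x (Fin.tail ys) false true s t *
          partition ys xs (Fin.cons true t) +
        ∑ t, rowWeight x (Fin.tail ys) true true s t * partition ys xs (Fin.cons false t) := by
  simp only [partition, sum_state_succ, rowWeight, Fin.cons_zero, Fin.tail_cons,
    Fintype.sum_bool, vertexWeight, zero_mul, zero_add, add_zero, one_mul, Finset.mul_sum]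
  congr 1
  exact sum_congr rfl fun _ _ => by ring

theorem rowWeight_true_true_full (x : ℝ × ℝ) {n : ℕ} (ys : Fin n → ℝ × ℝ) (t : Fin n → Bool) :
    rowWeight x ys true true (fun _ => true) t =
      if t = fun _ => true then ∏ l, weightA x (ys l) else 0 := by
  induction n with
  | zero => simp [rowWeight, eq_iff_true_of_subsingleton]
  | succ n ih =>
    induction t using Fin.consCases with
    | _ b t =>
    simp only [cons_eq_const, rowWeight, Fin.tail_cons, Fin.cons_zero, tail_const]
    cases b <;> simp [vertexWeight, ih, Fin.prod_univ_succ, Fin.tail_def]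

theorem rowWeight_true_true_empty (x : ℝ × ℝ) {n : ℕ} (ys : Fin n → ℝ × ℝ) (s : Fin n → Bool) :
    rowWeight x ys true true s (fun _ => false) =
      if s = fun _ => false then ∏ l, weightB x (ys l) else 0 := by
  induction n with
  | zero => simp [rowWeight, eq_iff_true_of_subsingleton]
  | succ n ih =>
    induction s using Fin.consCases with
    | _ b s =>
    simp only [cons_eq_const, rowWeight, Fin.tail_cons, Fin.cons_zero, tail_const]
    cases b <;> simp [vertexWeight, ih, Fin.prod_univ_succ, Fin.tail_def]

/-- If the bottom row may not be crossed vertically in the first column, then the path that starts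
there turns right at once, and the bottom row and the first column are frozen. -/
theorem partition_freeze_bottom {n : ℕ} (ys : Fin (n + 1) → ℝ × ℝ) {x : ℝ × ℝ}
    (h : weightB x (ys 0) = 0) (xs : List (ℝ × ℝ)) :
    partition ys (x :: xs) (fun _ => true) =
      (∏ l, weightA x (Fin.tail ys l)) * (xs.map fun z => weightA z (ys 0)).prod *
        partition (Fin.tail ys) xs (fun _ => true) := by
  rw [cons_const, partition_cons_true, h, zero_mul, zero_add]
  simp [rowWeight_true_true_full, partition_cons_false, mul_assoc]

/-- If the top row has no empty vertex in the first column, then the path that starts there goes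
up to the top row, and the top row and the first column are frozen. -/
theorem partition_freeze_top {n : ℕ} (ys : Fin (n + 1) → ℝ × ℝ) {x : ℝ × ℝ}
    (h : weightA x (ys 0) = 0) (xs : List (ℝ × ℝ)) (s : Fin n → Bool) :
    partition ys (xs ++ [x]) (Fin.cons true s) =
      (∏ l, weightB x (Fin.tail ys l)) * (xs.map fun z => weightB z (ys 0)).prod *
        partition (Fin.tail ys) xs s := by
  have hf : ∀ (xs : List (ℝ × ℝ)) t, partition ys (xs ++ [x]) (Fin.cons false t) = 0 := by
    intro xs t
    rw [partition_cons_false]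
    simp [h]
  induction xs generalizing s with
  | nil =>
    simp only [List.nil_append, List.map_nil, List.prod_nil, mul_one]
    rw [partition_cons_true]
    simp [partition, cons_eq_const, rowWeight_true_true_empty]
  | cons z xs ih =>
    rw [List.cons_append, partition_cons_true]
    simp only [ih, hf, mul_zero, sum_const_zero, add_zero, partition, Finset.mul_sum,
      List.map_cons, List.prod_cons]
    exact sum_congr rfl fun _ _ => by ring

open Polynomial in
theorem degree_C_mul_le' (a : ℝ) (p : ℝ[X]) : (C a * p).degree ≤ p.degree := by
  rw [← smul_eq_C_mul]
  exact degree_smul_le a p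

open Polynomial in
/-- In the parameter of the first column, the partition function is a polynomial of degree less
than the number of rows, since one vertex of that column is a turn of weight `1`. -/
theorem partition_degree {n : ℕ} (ys : Fin n → ℝ × ℝ) (xs : List (ℝ × ℝ)) (s : Fin n → Bool) :
    ∃ Q : ℝ[X], Q.degree < xs.length ∧
      ∀ r : ℝ, partition (Fin.cons (r, 1) ys : Fin (n + 1) → ℝ × ℝ) xs (Fin.cons true s) =
        Q.eval r := by
  induction xs generalizing s with
  | nil =>
    refine ⟨0, by simp, fun r => ?_⟩
    simp [partition, cons_eq_const]
  | cons x xs ih =>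
    choose Q hdeg hQ using ih
    -- the weights `weightA z (r, 1)` as polynomials in `r`
    set P : ℝ × ℝ → ℝ[X] := fun z => C z.1 * Polynomial.X + C z.2 * (Polynomial.X + C 1) with hP
    have hPdeg : ∀ z, (P z).degree ≤ 1 := fun z => by
      simp only [hP]
      compute_degree
    have hprod : ∀ l : List (ℝ × ℝ), ((l.map P).prod).degree ≤ l.length := by
      intro l
      induction l with
      | nil => simp
      | cons w l ihl =>
        simp only [List.map_cons, List.prod_cons, List.length_cons, Nat.cast_add, Nat.cast_one]
        rw [add_comm]
        exact (degree_mul_le _ _).trans (add_le_add (hPdeg w) ihl)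
    refine ⟨(C x.1 * (Polynomial.X + C 1) + C x.2) *
        ∑ t, C (rowWeight x ys false true s t) * Q t +
        ∑ t, C (rowWeight x ys true true s t * partition ys xs t) * (xs.map P).prod, ?_, ?_⟩
    · have hlt : ((xs.length : ℕ) : WithBot ℕ) < ((x :: xs).length : ℕ) := by
        simp only [List.length_cons]
        exact_mod_cast Nat.lt_succ_self _
      refine (degree_add_le _ _).trans_lt (max_lt ?_ ?_)
      · have h1 : (∑ t, C (rowWeight x ys false true s t) * Q t).degree < (xs.length : ℕ) := by
          refine (degree_sum_le _ _).trans_lt ?_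
          rw [Finset.sup_lt_iff (WithBot.bot_lt_coe _)]
          intro t _
          exact (degree_C_mul_le' _ _).trans_lt (hdeg t)
        have h2 : (C x.1 * (Polynomial.X + C 1) + C x.2).degree ≤ 1 := by compute_degree
        refine (degree_mul_le _ _).trans_lt ?_
        simp only [List.length_cons, Nat.cast_add, Nat.cast_one]
        rw [add_comm (xs.length : WithBot ℕ)]
        by_cases h0 : (∑ t, C (rowWeight x ys false true s t) * Q t) = 0
        · rw [h0, degree_zero, WithBot.add_bot]
          exact_mod_cast WithBot.bot_lt_coe _
        · rw [degree_eq_natDegree h0] at h1 ⊢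
          refine (add_le_add_left h2 _).trans_lt ?_
          have h1' : (∑ t, C (rowWeight x ys false true s t) * Q t).natDegree < xs.length := by
            exact_mod_cast h1
          exact_mod_cast Nat.add_lt_add_left h1' 1
      · refine lt_of_le_of_lt ((degree_sum_le _ _).trans ?_) hlt
        refine Finset.sup_le fun t _ => (degree_C_mul_le' _ _).trans (hprod xs)
    · intro r
      rw [partition_cons_true]
      simp only [Fin.tail_cons, Fin.cons_zero, hQ, partition_cons_false, eval_add, eval_mul,
        eval_finsetSum, eval_C, eval_X, weightB]
      congr 1
      · ring
      · refine sum_congr rfl fun t _ => ?_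
        have : ((xs.map P).prod).eval r = (xs.map fun z => weightA z (r, 1)).prod := by
          rw [eval_list_prod, List.map_map]
          congr 2
          funext z
          simp [hP, weightA]
        rw [this]
        ring

/-! ### The three-term relation -/

/-- The partition function with domain wall boundary and bottom row parameter `x`, multiplied by
the brackets of `x` with all other parameters. The factors make the sum over the three rotations
of `x` vanish. -/
def dressed {n : ℕ} (ys : Fin n → ℝ × ℝ) (xs : List (ℝ × ℝ)) (x : ℝ × ℝ) : ℝ :=
  (xs.map (bracket x)).prod * (∏ l, bracket x (ys l)) * partition ys (x :: xs) fun _ => true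

/-- Freezing by a row `z` of any position: by symmetry it may be moved to the bottom. -/
theorem dressed_freeze_bottom {n : ℕ} (ys : Fin (n + 1) → ℝ × ℝ) {x z : ℝ × ℝ}
    (l₁ l₂ : List (ℝ × ℝ)) (h : weightB z (ys 0) = 0) (hx : bracket z (rot x) ≠ 0)
    (hl : ∀ w ∈ l₁, bracket z (rot w) ≠ 0) :
    dressed ys (l₁ ++ z :: l₂) x =
      (∏ l, weightA z (Fin.tail ys l)) * ((l₁ ++ l₂).map fun w => weightA w (ys 0)).prod *
        (bracket x z * bracket x (ys 0) * weightA x (ys 0)) *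
        dressed (Fin.tail ys) (l₁ ++ l₂) x := by
  have hp : partition ys (x :: (l₁ ++ z :: l₂)) (fun _ => true) =
      partition ys (z :: (x :: l₁ ++ l₂)) (fun _ => true) :=
    partition_move_front ys (x :: l₁) l₂ (by simpa [hx] using hl) _
  rw [dressed, hp, partition_freeze_bottom ys h, dressed, Fin.prod_univ_succ]
  simp only [List.map_append, List.prod_append, List.map_cons, List.prod_cons, List.cons_append,
    Fin.tail_def]
  ring

/-- Freezing by a row `z` of any position other than that of `x`: by symmetry it may be moved to
the top. -/
theorem dressed_freeze_top {n : ℕ} (ys : Fin (n + 1) → ℝ × ℝ) {x z : ℝ × ℝ}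
    (l₁ l₂ : List (ℝ × ℝ)) (h : weightA z (ys 0) = 0)
    (hl : ∀ w ∈ l₂, bracket z (rot w) ≠ 0) :
    dressed ys (l₁ ++ z :: l₂) x =
      (∏ l, weightB z (Fin.tail ys l)) * ((l₁ ++ l₂).map fun w => weightB w (ys 0)).prod *
        (bracket x z * bracket x (ys 0) * weightB x (ys 0)) *
        dressed (Fin.tail ys) (l₁ ++ l₂) x := by
  have hp : partition ys (x :: (l₁ ++ z :: l₂)) (fun _ => true) =
      partition ys ((x :: (l₁ ++ l₂)) ++ [z]) (fun _ => true) :=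
    partition_move_end ys (x :: l₁) l₂ hl _
  rw [dressed, hp, cons_const, partition_freeze_top ys h, dressed, Fin.prod_univ_succ]
  simp only [List.map_append, List.prod_append, List.map_cons, List.prod_cons,
    Fin.tail_def]
  ring

/-- The next three lemmas are the conditions for exchanging the row `(X, 1)` with the rows
`(Y, 1)`, `rot (Y, 1)` and `rot (rot (Y, 1))`. -/
theorem bracket_rot_ne {X Y : ℝ} (hX : 0 < X) (hY : 0 < Y) :
    bracket (X, 1) (rot (Y, 1)) ≠ 0 := by
  simp only [bracket, rot]
  nlinarith [mul_pos hX hY]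

theorem bracket_rot_rot_ne {X Y : ℝ} (hX : 0 < X) (hY : 0 < Y) :
    bracket (X, 1) (rot (rot (Y, 1))) ≠ 0 := by
  simp only [bracket, rot]
  nlinarith [mul_pos hX hY]

theorem bracket_rot_rot_rot_ne {X Y : ℝ} (h : X ≠ Y) :
    bracket (X, 1) (rot (rot (rot (Y, 1)))) ≠ 0 := by
  simp only [bracket, rot]
  intro h'
  apply h
  linarith

open Polynomial in
theorem dressed_degree {n : ℕ} (ys : Fin n → ℝ × ℝ) (xs : List (ℝ × ℝ)) (x : ℝ × ℝ) :
    ∃ Q : ℝ[X], Q.degree < xs.length + 2 ∧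
      ∀ r : ℝ, dressed (Fin.cons (r, 1) ys : Fin (n + 1) → ℝ × ℝ) xs x = Q.eval r := by
  obtain ⟨Q, hdeg, hQ⟩ := partition_degree ys (x :: xs) (fun _ => true)
  refine ⟨C ((xs.map (bracket x)).prod * ∏ l, bracket x (ys l)) *
    ((C x.1 - C x.2 * Polynomial.X) * Q), ?_, fun r => ?_⟩
  · refine (degree_C_mul_le' _ _).trans_lt ((degree_mul_le _ _).trans_lt ?_)
    have h2 : (C x.1 - C x.2 * Polynomial.X).degree ≤ 1 := by compute_degree
    by_cases h0 : Q = 0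
    · rw [h0, degree_zero, WithBot.add_bot]
      exact_mod_cast WithBot.bot_lt_coe (xs.length + 2)
    · rw [degree_eq_natDegree h0] at hdeg ⊢
      refine (add_le_add_left h2 _).trans_lt ?_
      have h1' : Q.natDegree < xs.length + 1 := by
        rw [List.length_cons] at hdeg
        exact_mod_cast hdeg
      have : 1 + Q.natDegree < xs.length + 2 := by omega
      exact_mod_cast this
  · rw [dressed, cons_const, hQ, Fin.prod_univ_succ]
    simp only [Fin.cons_zero, Fin.cons_succ, eval_mul, eval_sub, eval_C, eval_X, bracket]
    ring

open Polynomial in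
/-- The three-term relation for generic parameters. The sum is a polynomial of degree at most
`n + 1` in the first column parameter. By induction it vanishes at the `2 n` points where one of
the `n` rows `Xs` freezes the first column, because the factors that come out there are the same
for the three rotations. For `n ≤ 1` these points are too few, and the sum is computed. -/
theorem dressed_three_term (n : ℕ) (Xs : List ℝ) (hlen : Xs.length = n) (ys : Fin (n + 1) → ℝ × ℝ)
    (hys : ∀ l, (ys l).2 = 1) {X : ℝ} (hX : 0 < X) (hpos : ∀ Z ∈ Xs, 0 < Z) (hnd : Xs.Nodup)
    (hmem : X ∉ Xs) :
    dressed ys (Xs.map fun Z => (Z, 1)) (X, 1) + dressed ys (Xs.map fun Z => (Z, 1)) (rot (X, 1)) +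
      dressed ys (Xs.map fun Z => (Z, 1)) (rot (rot (X, 1))) = 0 := by
  induction n generalizing Xs with
  | zero =>
    obtain rfl := List.length_eq_zero_iff.1 hlen
    have h1 : ∀ x, partition ys [x] (fun _ => true) = 1 := by
      intro x
      rw [cons_const, partition_cons_true]
      simp [partition, cons_eq_const, rowWeight, eq_iff_true_of_subsingleton]
    simp [dressed, h1, bracket, rot]
    ring
  | succ n ih =>
    obtain ⟨y, ys, rfl⟩ : ∃ y ys', ys = Fin.cons y ys' := ⟨_, _, (Fin.cons_self_tail ys).symm⟩
    rcases Nat.eq_zero_or_pos n with rfl | hn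
    · obtain ⟨Z, rfl⟩ := List.length_eq_one_iff.1 hlen
      have h1 : ∀ x z, partition (Fin.cons y ys : Fin 2 → ℝ × ℝ) [x, z] (fun _ => true) =
          weightB x y * weightB z (ys 0) + weightA x (ys 0) * weightA z y := by
        intro x z
        rw [cons_const, partition_cons_true]
        simp [partition, rowWeight, tail_const, sum_state_succ, vertexWeight]
      simp [dressed, h1, bracket, rot, weightA, weightB]
      ring
    · set xs : List (ℝ × ℝ) := Xs.map fun Z => (Z, 1) with hxs
      have hxl : xs.length = n + 1 := by simp [hxs, hlen]
      obtain ⟨Q₁, hd₁, hQ₁⟩ := dressed_degree ys xs (X, 1)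
      obtain ⟨Q₂, hd₂, hQ₂⟩ := dressed_degree ys xs (rot (X, 1))
      obtain ⟨Q₃, hd₃, hQ₃⟩ := dressed_degree ys xs (rot (rot (X, 1)))
      have hy : y = (y.1, 1) := Prod.ext rfl (by simpa using hys 0)
      have hys' : ∀ l, (ys l).2 = 1 := fun l => by simpa using hys l.succ
      rw [hy, hQ₁, hQ₂, hQ₃, ← eval_add, ← eval_add]
      suffices h : Q₁ + Q₂ + Q₃ = 0 by rw [h, eval_zero]
      -- the values of the first column parameter at which the row `Z` loses its weight
      -- `weightB` or `weightA` in that column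
      set ρ₁ : ℝ → ℝ := fun Z => -(1 + Z) / Z with hρ₁
      set ρ₂ : ℝ → ℝ := fun Z => -1 / (1 + Z) with hρ₂
      have hrange₁ : ∀ Z, 0 < Z → ρ₁ Z < -1 := fun Z hZ => by
        rw [hρ₁, div_lt_iff₀ hZ]
        linarith
      have hrange₂ : ∀ Z, 0 < Z → -1 < ρ₂ Z := fun Z hZ => by
        rw [hρ₂, lt_div_iff₀ (by linarith)]
        linarith
      have hcard : (Xs.toFinset.image ρ₁ ∪ Xs.toFinset.image ρ₂).card = 2 * (n + 1) := by
        rw [Finset.card_union_of_disjoint, Finset.card_image_of_injOn, Finset.card_image_of_injOn,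
          List.toFinset_card_of_nodup hnd, hlen]
        · ring
        · intro Z hZ W hW h
          have hZ := hpos Z (by simpa using hZ)
          have hW := hpos W (by simpa using hW)
          simp only [hρ₂] at h
          rw [div_eq_div_iff (by linarith) (by linarith)] at h
          linarith
        · intro Z hZ W hW h
          have hZ := hpos Z (by simpa using hZ)
          have hW := hpos W (by simpa using hW)
          simp only [hρ₁] at h
          rw [div_eq_div_iff hZ.ne' hW.ne'] at h
          linarith
        · rw [Finset.disjoint_left]
          intro r h1 h2
          simp only [Finset.mem_image, List.mem_toFinset] at h1 h2
          obtain ⟨Z, hZ, rfl⟩ := h1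
          obtain ⟨W, hW, h⟩ := h2
          have := hrange₁ Z (hpos Z hZ)
          have := hrange₂ W (hpos W hW)
          linarith
      refine eq_zero_of_degree_lt_of_eval_finset_eq_zero
        (Xs.toFinset.image ρ₁ ∪ Xs.toFinset.image ρ₂) ?_ ?_
      · rw [hcard]
        have hb : ((xs.length : WithBot ℕ) + 2) ≤ ((2 * (n + 1) : ℕ) : WithBot ℕ) := by
          rw [hxl]
          have : n + 1 + 2 ≤ 2 * (n + 1) := by omega
          exact_mod_cast this
        refine lt_of_lt_of_le ?_ hb
        exact (degree_add_le _ _).trans_lt (max_lt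
          ((degree_add_le _ _).trans_lt (max_lt hd₁ hd₂)) hd₃)
      · intro r hr
        rw [eval_add, eval_add, ← hQ₁, ← hQ₂, ← hQ₃]
        rw [Finset.mem_union, Finset.mem_image, Finset.mem_image] at hr
        -- the induction hypothesis for the rows that remain when `Z` is removed
        have hsub : ∀ L₁ L₂ : List ℝ, ∀ Z, Xs = L₁ ++ Z :: L₂ → 0 < Z ∧ Z ≠ X ∧
            (∀ W ∈ L₁ ++ L₂, 0 < W) ∧ dressed ys ((L₁ ++ L₂).map fun Z => (Z, 1)) (X, 1) +
              dressed ys ((L₁ ++ L₂).map fun Z => (Z, 1)) (rot (X, 1)) +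
              dressed ys ((L₁ ++ L₂).map fun Z => (Z, 1)) (rot (rot (X, 1))) = 0 := by
          rintro L₁ L₂ Z rfl
          have hp : ∀ W ∈ L₁ ++ L₂, 0 < W := fun W hW => hpos W (by
            simp only [List.mem_append, List.mem_cons] at hW ⊢; tauto)
          refine ⟨hpos Z (by simp), fun h => hmem (by simp [h]), hp, ?_⟩
          refine ih (L₁ ++ L₂) ?_ ys hys' hp ?_ ?_
          · simp at hlen ⊢; omega
          · exact hnd.sublist (List.Sublist.append_left (List.sublist_cons_self _ _) _)
          · simp only [List.mem_append, List.mem_cons] at hmem ⊢; tauto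
        have hZ' : ∀ L₁ L₂ : List ℝ, ∀ Z, Xs = L₁ ++ Z :: L₂ →
            xs = L₁.map (fun Z => ((Z, 1) : ℝ × ℝ)) ++ (Z, 1) :: L₂.map fun Z => (Z, 1) := by
          rintro L₁ L₂ Z rfl
          simp [hxs]
        rcases hr with ⟨Z, hZ, rfl⟩ | ⟨Z, hZ, rfl⟩ <;>
          obtain ⟨L₁, L₂, hL⟩ := List.append_of_mem (List.mem_toFinset.1 hZ) <;>
          obtain ⟨hZ0, hZX, hp, hih⟩ := hsub L₁ L₂ Z hL <;>
          rw [hZ' L₁ L₂ Z hL]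
        · have hw : weightB (Z, 1) ((Fin.cons (ρ₁ Z, 1) ys : Fin (n + 2) → ℝ × ℝ) 0) = 0 := by
            simp only [Fin.cons_zero, weightB, hρ₁]
            field_simp
            ring
          have hne : ∀ w ∈ L₁.map (fun Z => ((Z, 1) : ℝ × ℝ)), bracket (Z, 1) (rot w) ≠ 0 := by
            intro w hw
            obtain ⟨W, hW, rfl⟩ := List.mem_map.1 hw
            exact bracket_rot_ne hZ0 (hp W (by simp [hW]))
          rw [dressed_freeze_bottom _ _ _ hw (bracket_rot_ne hZ0 hX) hne,
            dressed_freeze_bottom _ _ _ hw (bracket_rot_rot_ne hZ0 hX) hne,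
            dressed_freeze_bottom _ _ _ hw (bracket_rot_rot_rot_ne hZX) hne]
          rw [List.map_append] at hih
          simp only [Fin.cons_zero, Fin.tail_cons]
          -- the only factors that depend on the bottom row are invariant under its rotation
          have e₂ : bracket (rot (X, 1)) (Z, 1) * bracket (rot (X, 1)) (ρ₁ Z, 1) *
              weightA (rot (X, 1)) (ρ₁ Z, 1) = bracket (X, 1) (Z, 1) *
                bracket (X, 1) (ρ₁ Z, 1) * weightA (X, 1) (ρ₁ Z, 1) := by
            simp only [bracket, weightA, rot, hρ₁]
            field_simp
            ring
          have e₃ : bracket (rot (rot (X, 1))) (Z, 1) * bracket (rot (rot (X, 1))) (ρ₁ Z, 1) *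
              weightA (rot (rot (X, 1))) (ρ₁ Z, 1) = bracket (X, 1) (Z, 1) *
                bracket (X, 1) (ρ₁ Z, 1) * weightA (X, 1) (ρ₁ Z, 1) := by
            simp only [bracket, weightA, rot, hρ₁]
            field_simp
            ring
          rw [e₂, e₃, ← mul_add, ← mul_add, hih, mul_zero]
        · have h1Z : 1 + Z ≠ 0 := by linarith
          have hw : weightA (Z, 1) ((Fin.cons (ρ₂ Z, 1) ys : Fin (n + 2) → ℝ × ℝ) 0) = 0 := by
            simp only [Fin.cons_zero, weightA, hρ₂]
            field_simp
            ring
          have hne : ∀ w ∈ L₂.map (fun Z => ((Z, 1) : ℝ × ℝ)), bracket (Z, 1) (rot w) ≠ 0 := by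
            intro w hw
            obtain ⟨W, hW, rfl⟩ := List.mem_map.1 hw
            exact bracket_rot_ne hZ0 (hp W (by simp [hW]))
          rw [dressed_freeze_top _ _ _ hw hne, dressed_freeze_top _ _ _ hw hne,
            dressed_freeze_top _ _ _ hw hne]
          rw [List.map_append] at hih
          simp only [Fin.cons_zero, Fin.tail_cons]
          have e₂ : bracket (rot (X, 1)) (Z, 1) * bracket (rot (X, 1)) (ρ₂ Z, 1) *
              weightB (rot (X, 1)) (ρ₂ Z, 1) = bracket (X, 1) (Z, 1) *
                bracket (X, 1) (ρ₂ Z, 1) * weightB (X, 1) (ρ₂ Z, 1) := by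
            simp only [bracket, weightB, rot, hρ₂]
            field_simp
            ring
          have e₃ : bracket (rot (rot (X, 1))) (Z, 1) * bracket (rot (rot (X, 1))) (ρ₂ Z, 1) *
              weightB (rot (rot (X, 1))) (ρ₂ Z, 1) = bracket (X, 1) (Z, 1) *
                bracket (X, 1) (ρ₂ Z, 1) * weightB (X, 1) (ρ₂ Z, 1) := by
            simp only [bracket, weightB, rot, hρ₂]
            field_simp
            ring
          rw [e₂, e₃, ← mul_add, ← mul_add, hih, mul_zero]

/-! ### Uniqueness of solutions of the three-term relation -/

open Polynomial in
/-- A nonzero polynomial with at most `k` terms is not divisible by `(X - 1) ^ k`: remove the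
power of `X`, differentiate to lose the constant term, and use induction. -/
theorem eq_zero_of_X_sub_one_pow_dvd (k : ℕ) (p : ℂ[X]) (hcard : p.support.card ≤ k)
    (hdvd : (X - 1) ^ k ∣ p) : p = 0 := by
  induction k generalizing p with
  | zero => simpa using hcard
  | succ k ih =>
    by_contra hp
    obtain ⟨m, q, hq, hpq⟩ : ∃ m q, ¬ (X : ℂ[X]) ∣ q ∧ p = X ^ m * q := by
      obtain ⟨q, hq, h⟩ := exists_eq_pow_rootMultiplicity_mul_and_not_dvd p hp 0
      rw [C_0, sub_zero] at hq h
      exact ⟨_, q, h, hq⟩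
    have hq0 : q.coeff 0 ≠ 0 := fun h => hq (X_dvd_iff.2 h)
    have hqcard : q.support.card ≤ k + 1 := by
      refine le_trans ?_ hcard
      refine Finset.card_le_card_of_injOn (fun e => e + m) ?_ (by
        intro a _ b _ h
        simpa using h)
      intro e he
      have he' : q.coeff e ≠ 0 := by simpa using he
      simp only [Finset.mem_coe, mem_support_iff, hpq]
      rwa [coeff_X_pow_mul]
    have hcop : IsCoprime ((X - 1 : ℂ[X]) ^ (k + 1)) (X ^ m) := by
      refine IsCoprime.pow ⟨-1, 1, by ring⟩
    have hqdvd : (X - 1 : ℂ[X]) ^ (k + 1) ∣ q := by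
      rw [hpq] at hdvd
      exact hcop.dvd_of_dvd_mul_left hdvd
    have hder : (derivative q).support.card ≤ k := by
      have h0 : (0 : ℕ) ∈ q.support := by simpa using hq0
      have : (q.support.erase 0).card ≤ k := by
        rw [Finset.card_erase_of_mem h0]
        omega
      refine le_trans ?_ this
      refine Finset.card_le_card_of_injOn (fun e => e + 1) ?_ (by
        intro a _ b _ h
        simpa using h)
      intro e he
      have he' : (derivative q).coeff e ≠ 0 := by simpa using he
      rw [coeff_derivative] at he'
      simp only [Finset.mem_coe, Finset.mem_erase, mem_support_iff]
      exact ⟨by omega, left_ne_zero_of_mul he'⟩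
    have hderdvd : (X - 1 : ℂ[X]) ^ k ∣ derivative q := by
      obtain ⟨w, rfl⟩ := hqdvd
      rw [derivative_mul]
      refine dvd_add ?_ ?_
      · rw [derivative_pow]
        simp only [Nat.add_sub_cancel]
        exact ((Dvd.intro_left _ rfl).mul_right _).mul_right _
      · exact (pow_dvd_pow _ (Nat.le_succ k)).mul_right _
    have hconst := derivative_eq_zero.1 (ih _ hder hderdvd)
    obtain ⟨c, rfl⟩ := natDegree_eq_zero.1 hconst
    have hroot : (X - 1 : ℂ[X]) ∣ C c := (dvd_pow_self _ (Nat.succ_ne_zero k)).trans hqdvd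
    have : (C c : ℂ[X]).IsRoot 1 := by
      rw [← dvd_iff_isRoot]
      simpa using hroot
    rw [IsRoot.def, eval_C] at this
    simp [this] at hq0

theorem exists_cubeRoot : ∃ ω : ℂ, ω ^ 2 + ω + 1 = 0 := by
  refine ⟨⟨-1 / 2, Real.sqrt 3 / 2⟩, ?_⟩
  have h3 : Real.sqrt 3 * Real.sqrt 3 = 3 := Real.mul_self_sqrt (by norm_num)
  apply Complex.ext
  · simp [pow_two]
    nlinarith
  · simp [pow_two]
    ring

theorem card_filter_mod_three (n : ℕ) (hn : 1 ≤ n) :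
    ((range (3 * n - 1)).filter fun e => e % 3 ≠ 2).card ≤ 2 * n := by
  have : ((range (3 * n - 1)).filter fun e => e % 3 ≠ 2) ⊆
      ((range n).image fun i => 3 * i) ∪ ((range n).image fun i => 3 * i + 1) := by
    intro e he
    simp only [Finset.mem_filter, Finset.mem_range, Finset.mem_union, Finset.mem_image] at he ⊢
    rcases Nat.lt_or_ge (e % 3) 1 with h | h
    · exact Or.inl ⟨e / 3, by omega, by omega⟩
    · exact Or.inr ⟨e / 3, by omega, by omega⟩
  refine (card_le_card this).trans ((card_union_le _ _).trans ?_)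
  have h1 := card_image_le (s := range n) (f := fun i => 3 * i)
  have h2 := card_image_le (s := range n) (f := fun i => 3 * i + 1)
  rw [card_range] at h1 h2
  omega

open Polynomial in
/-- The three-term relation for the binary form of degree `3 n - 2` attached to `p` says, in the
coordinate `x` that diagonalises the rotation, that the terms of degree `2` modulo `3` vanish.
At most `2 n` terms remain, whereas the zero of order `2 n` of `p` at `0` becomes one at `x = 1`. -/
theorem eq_zero_of_three_term (n : ℕ) (hn : 1 ≤ n) (p : ℝ[X]) (hdeg : p.natDegree ≤ 3 * n - 2)
    (hdvd : X ^ (2 * n) ∣ p) (S : Set ℝ) (hS : S.Infinite) (hpos : ∀ t ∈ S, 0 < t)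
    (h : ∀ t ∈ S, p.eval t + (-t - 1) ^ (3 * n - 2) * p.eval (1 / (-t - 1)) +
      t ^ (3 * n - 2) * p.eval ((-t - 1) / t) = 0) : p = 0 := by
  set N := 3 * n - 2 with hN
  obtain ⟨ω, hω⟩ := exists_cubeRoot
  have hω3 : ω ^ 3 = 1 := by linear_combination (ω - 1) * hω
  -- the binary form of degree `N` attached to `p`
  set H : ℂ → ℂ → ℂ := fun u v => ∑ j ∈ range (N + 1), (p.coeff j : ℂ) * u ^ j * v ^ (N - j)
    with hH
  have hHmul : ∀ c u v, H (c * u) (c * v) = c ^ N * H u v := by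
    intro c u v
    simp only [hH, Finset.mul_sum]
    refine sum_congr rfl fun j hj => ?_
    have hj' : j ≤ N := Nat.lt_succ_iff.1 (mem_range.1 hj)
    rw [mul_pow, mul_pow]
    have : c ^ N = c ^ j * c ^ (N - j) := by rw [← pow_add, Nat.add_sub_cancel' hj']
    rw [this]
    ring
  have hpev : ∀ t : ℝ, p.eval t = ∑ j ∈ range (N + 1), p.coeff j * t ^ j := fun t =>
    eval_eq_sum_range' (Nat.lt_succ_of_le hdeg) t
  have hscale : ∀ a b : ℝ, b ≠ 0 → b ^ N * p.eval (a / b) =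
      ∑ j ∈ range (N + 1), p.coeff j * a ^ j * b ^ (N - j) := by
    intro a b hb
    rw [hpev, Finset.mul_sum]
    refine sum_congr rfl fun j hj => ?_
    have hj' : j ≤ N := Nat.lt_succ_iff.1 (mem_range.1 hj)
    have : b ^ N = b ^ j * b ^ (N - j) := by rw [← pow_add, Nat.add_sub_cancel' hj']
    rw [this, div_pow]
    field_simp
  -- the relation as an identity of real polynomials
  set r : ℝ[X] := p + ∑ j ∈ range (N + 1), C (p.coeff j) * (-X - 1) ^ (N - j) +
    ∑ j ∈ range (N + 1), C (p.coeff j) * (-X - 1) ^ j * X ^ (N - j) with hr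
  have hr0 : r = 0 := by
    refine eq_zero_of_infinite_isRoot r (hS.mono fun t ht => ?_)
    have ht0 := hpos t ht
    have := h t ht
    rw [hscale _ _ (by linarith), hscale _ _ ht0.ne'] at this
    simpa [hr, IsRoot.def, eval_finsetSum] using this
  have hz : ∀ z : ℂ, H z 1 + H 1 (-z - 1) + H (-z - 1) z = 0 := by
    intro z
    have h1 : eval₂ (algebraMap ℝ ℂ) z r = 0 := by rw [hr0, eval₂_zero]
    have h2 : eval₂ (algebraMap ℝ ℂ) z p = H z 1 := by
      rw [eval₂_eq_sum_range' _ (Nat.lt_succ_of_le hdeg)]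
      simp [hH]
    rw [hr, eval₂_add, eval₂_add, h2] at h1
    simpa [hH, eval₂_finsetSum, eval₂_mul, eval₂_pow] using h1
  have huv : ∀ u v : ℂ, v ≠ 0 → H u v + H v (-u - v) + H (-u - v) u = 0 := by
    intro u v hv
    have e1 : H u v = v ^ N * H (u / v) 1 := by
      rw [← hHmul, mul_div_cancel₀ _ hv, mul_one]
    have e2 : H v (-u - v) = v ^ N * H 1 (-(u / v) - 1) := by
      rw [← hHmul, mul_one]
      congr 1
      field_simp
    have e3 : H (-u - v) u = v ^ N * H (-(u / v) - 1) (u / v) := by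
      rw [← hHmul, mul_div_cancel₀ _ hv]
      congr 1
      field_simp
    rw [e1, e2, e3, ← mul_add, ← mul_add, hz, mul_zero]
  -- the same form in the coordinate that diagonalises the rotation
  set q : ℂ[X] := ∑ j ∈ range (N + 1), C (p.coeff j : ℂ) * (X - 1) ^ j *
    (C ω * X - C (ω ^ 2)) ^ (N - j) with hq
  have hqev : ∀ x, q.eval x = H (x - 1) (ω * x - ω ^ 2) := by
    intro x
    simp [hq, hH, eval_finsetSum]
  have hqdeg : q.natDegree ≤ N := by
    rw [hq]
    refine natDegree_sum_le_of_forall_le _ _ fun j hj => ?_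
    have hj' : j ≤ N := Nat.lt_succ_iff.1 (mem_range.1 hj)
    have h1 : ((X - 1 : ℂ[X]) ^ j).natDegree ≤ j := by
      have : (X - 1 : ℂ[X]).natDegree ≤ 1 := by compute_degree
      exact (natDegree_pow_le_of_le j this).trans (by simp)
    have h2 : ((C ω * X - C (ω ^ 2) : ℂ[X]) ^ (N - j)).natDegree ≤ N - j := by
      have : (C ω * X - C (ω ^ 2) : ℂ[X]).natDegree ≤ 1 := by compute_degree
      exact (natDegree_pow_le_of_le (N - j) this).trans (by simp)
    have := natDegree_mul_le_of_le (natDegree_mul_le_of_le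
      (natDegree_C (p.coeff j : ℂ)).le h1) h2
    exact this.trans (by omega)
  have hqdvd : (X - 1 : ℂ[X]) ^ (2 * n) ∣ q := by
    rw [hq]
    refine Finset.dvd_sum fun j _ => ?_
    rcases Nat.lt_or_ge j (2 * n) with hj | hj
    · rw [X_pow_dvd_iff.1 hdvd j hj]
      simp
    · exact ((pow_dvd_pow _ hj).mul_left _).mul_right _
  have hqrel : q + C (ω ^ 2) * q.comp (C (ω ^ 2) * X) + C ω * q.comp (C ω * X) = 0 := by
    refine eq_zero_of_infinite_isRoot _ ((Set.finite_singleton ω).infinite_compl.mono ?_)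
    intro x hx
    have hx' : ω * x - ω ^ 2 ≠ 0 := by
      intro h0
      have : ω * (x - ω) = 0 := by linear_combination h0
      rcases mul_eq_zero.1 this with h' | h'
      · rw [h'] at hω3
        norm_num at hω3
      · exact hx (sub_eq_zero.1 h')
    have hωN : ω ^ N = ω := by
      have : N = 3 * (n - 1) + 1 := by omega
      rw [this, pow_succ, pow_mul, hω3, one_pow, one_mul]
    have hω2N : (ω ^ 2) ^ N = ω ^ 2 := by rw [← pow_mul, mul_comm, pow_mul, hωN]
    have key := huv (x - 1) (ω * x - ω ^ 2) hx'
    have e2 : H (ω * x - ω ^ 2) (-(x - 1) - (ω * x - ω ^ 2)) = ω ^ 2 * q.eval (ω ^ 2 * x) := by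
      rw [hqev, ← hω2N, ← hHmul, hω2N]
      congr 1
      · linear_combination (-ω * x) * hω3
      · linear_combination (-ω ^ 2 * x + ω) * hω3 + (-x + 1) * hω
    have e3 : H (-(x - 1) - (ω * x - ω ^ 2)) (x - 1) = ω * q.eval (ω * x) := by
      rw [hqev]
      conv_rhs => rw [← hωN]
      rw [hωN]
      have := hHmul ω (ω * x - 1) (ω * (ω * x) - ω ^ 2)
      rw [hωN] at this
      rw [← this]
      congr 1
      · linear_combination (-x + 1) * hω
      · linear_combination (-x + 1) * hω3
    rw [e2, e3, ← hqev] at key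
    simpa [IsRoot.def, eval_comp] using key
  have hqsupp : q.support ⊆ (range (3 * n - 1)).filter fun e => e % 3 ≠ 2 := by
    intro e he
    rw [Finset.mem_filter, Finset.mem_range]
    refine ⟨?_, fun hmod => ?_⟩
    · have := le_natDegree_of_mem_supp e he
      omega
    · have hc := congrArg (fun f => coeff f e) hqrel
      simp only [coeff_add, coeff_C_mul, comp_C_mul_X_coeff, coeff_zero] at hc
      have h1 : ω ^ (e + 1) = 1 := by
        have : e + 1 = 3 * (e / 3 + 1) := by omega
        rw [this, pow_mul, hω3, one_pow]
      have h2 : ω * ω ^ e = 1 := by rw [← h1]; ring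
      have h3 : ω ^ 2 * (ω ^ 2) ^ e = 1 := by
        have : ω ^ 2 * (ω ^ 2) ^ e = (ω ^ (e + 1)) ^ 2 := by ring
        rw [this, h1, one_pow]
      have : 3 * q.coeff e = 0 := by linear_combination hc - q.coeff e * h3 - q.coeff e * h2
      have : q.coeff e = 0 := by simpa using this
      exact (mem_support_iff.1 he) this
  have hq0 : q = 0 := eq_zero_of_X_sub_one_pow_dvd (2 * n) q
    ((card_le_card hqsupp).trans (card_filter_mod_three n hn)) hqdvd
  -- every real number is of the form `(x - 1) / (ω x - ω²)`
  have hωre : ∀ t : ℝ, (t : ℂ) * ω - 1 ≠ 0 := by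
    intro t ht
    have e1 : (t : ℂ) * ω = 1 := sub_eq_zero.1 ht
    have e2 : (t : ℂ) ^ 2 + t + 1 = 0 := by
      have : (t : ℂ) ^ 2 * (ω ^ 2 + ω + 1) = 0 := by rw [hω, mul_zero]
      linear_combination this - (t * ω + 1 + t) * e1
    have e3 : t ^ 2 + t + 1 = 0 := by exact_mod_cast e2
    nlinarith [sq_nonneg (2 * t + 1)]
  refine funext fun t => ?_
  rw [eval_zero]
  set x : ℂ := (t * ω ^ 2 - 1) / (t * ω - 1) with hx
  have hxe : x * (t * ω - 1) = t * ω ^ 2 - 1 := div_mul_cancel₀ _ (hωre t)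
  have hrel : x - 1 = t * (ω * x - ω ^ 2) := by linear_combination -hxe
  have hv : ω * x - ω ^ 2 ≠ 0 := by
    intro h0
    rw [h0, mul_zero] at hrel
    have hx1 : x = 1 := sub_eq_zero.1 hrel
    rw [hx1] at h0
    have h1 : ω = -1 / 2 := by linear_combination (h0 + hω) / 2
    rw [h1] at hω
    norm_num at hω
  have hHx : H (x - 1) (ω * x - ω ^ 2) = 0 := by rw [← hqev, hq0, eval_zero]
  rw [hrel] at hHx
  have hHt : H (t * (ω * x - ω ^ 2)) (ω * x - ω ^ 2) = (ω * x - ω ^ 2) ^ N * H t 1 := by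
    rw [← hHmul, mul_one, mul_comm]
  rw [hHt] at hHx
  have := (mul_eq_zero.1 hHx).resolve_left (pow_ne_zero _ hv)
  have hcast : H t 1 = ((p.eval t : ℝ) : ℂ) := by
    rw [hpev]
    simp [hH]
  rw [hcast] at this
  exact_mod_cast this

/-! ### The homogeneous point -/

/-- The spectral parameter at which, taken for a row and a column, all six weights are `1`. -/
def unitParam : ℝ × ℝ := (0, 1)

/-- The partition function of `k` rows over the state `s` of `n` columns, with all weights `1`. -/
noncomputable def chainCount (n k : ℕ) (s : Fin n → Bool) : ℝ :=
  partition (fun _ : Fin n => unitParam) (List.replicate k unitParam) s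

/-- The state in which all columns but `k` are occupied. -/
def fullExcept {n : ℕ} (k : Fin n) : Fin n → Bool := Function.update (fun _ => true) k false

theorem fullExcept_zero {n : ℕ} : fullExcept (0 : Fin (n + 1)) = Fin.cons false fun _ => true := by
  funext i
  refine Fin.cases ?_ (fun j => ?_) i
  · simp [fullExcept]
  · simp [fullExcept]

theorem fullExcept_succ {n : ℕ} (k : Fin n) : fullExcept k.succ = Fin.cons true (fullExcept k) := by
  funext i
  refine Fin.cases ?_ (fun j => ?_) i
  · simp [fullExcept, (Fin.succ_ne_zero k).symm]
  · simp [fullExcept, Function.update_apply, Fin.succ_inj]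

theorem weightA_unit (x : ℝ × ℝ) : weightA x unitParam = x.2 := by simp [weightA, unitParam]

theorem weightB_unit (x : ℝ × ℝ) : weightB x unitParam = x.1 + x.2 := by simp [weightB, unitParam]

/-- A row over a full state has one path too many, so it empties exactly one column `k`; the path
of that column turns right, and the columns to its left are crossed vertically. -/
theorem sum_rowWeight_full (x : ℝ × ℝ) {n : ℕ} (φ : (Fin n → Bool) → ℝ) :
    ∑ t, rowWeight x (fun _ => unitParam) false true (fun _ => true) t * φ t =
      ∑ k : Fin n, (x.1 + x.2) ^ (k : ℕ) * x.2 ^ (n - 1 - k) * φ (fullExcept k) := by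
  induction n with
  | zero => simp [rowWeight]
  | succ n ih =>
    rw [sum_state_succ, Fin.sum_univ_succ]
    simp only [Fintype.sum_bool, rowWeight, Fin.cons_zero, Fin.tail_cons, tail_const,
      vertexWeight, zero_mul, add_zero, zero_add, one_mul, fullExcept_zero, fullExcept_succ]
    rw [add_comm]
    congr 1
    · have : Fin.tail (fun _ : Fin (n + 1) => unitParam) = fun _ => unitParam := rfl
      simp [this, rowWeight_true_true_full, weightA_unit]
    · have h := ih fun t => φ (Fin.cons true t)
      have h' : ∀ t, weightB x unitParam * rowWeight x (Fin.tail fun _ => unitParam) false true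
          (fun _ : Fin n => true) t * φ (Fin.cons true t) = weightB x unitParam *
          (rowWeight x (fun _ => unitParam) false true (fun _ => true) t *
            φ (Fin.cons true t)) := fun t => mul_assoc _ _ _
      simp only [h', ← Finset.mul_sum, h]
      rw [Finset.mul_sum, weightB_unit]
      refine sum_congr rfl fun k _ => ?_
      rw [Fin.val_succ, pow_succ, show n + 1 - 1 - ((k : ℕ) + 1) = n - 1 - k by omega]
      ring

theorem partition_full (x : ℝ × ℝ) (xs : List (ℝ × ℝ)) (n : ℕ) :
    partition (fun _ : Fin n => unitParam) (x :: xs) (fun _ => true) =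
      ∑ k : Fin n, (x.1 + x.2) ^ (k : ℕ) * x.2 ^ (n - 1 - k) *
        partition (fun _ : Fin n => unitParam) xs (fullExcept k) :=
  sum_rowWeight_full x _

theorem rowWeight_unit_nonneg {n : ℕ} (h k : Bool) (s t : Fin n → Bool) :
    0 ≤ rowWeight unitParam (fun _ => unitParam) h k s t := by
  induction n generalizing h with
  | zero =>
    simp only [rowWeight]
    split_ifs <;> norm_num
  | succ n ih =>
    simp only [rowWeight]
    refine sum_nonneg fun m _ => mul_nonneg ?_ (ih _ _ _)
    generalize s 0 = a, t 0 = b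
    cases h <;> cases m <;> cases a <;> cases b <;>
      norm_num [vertexWeight, weightA, weightB, normForm, unitParam]

theorem chainCount_nonneg (n k : ℕ) (s : Fin n → Bool) : 0 ≤ chainCount n k s := by
  induction k generalizing s with
  | zero =>
    simp only [chainCount, List.replicate_zero, partition]
    split_ifs <;> norm_num
  | succ k ih =>
    simp only [chainCount, List.replicate_succ, partition]
    exact sum_nonneg fun t _ => mul_nonneg (rowWeight_unit_nonneg _ _ _ _) (ih t)

theorem chainCount_fullExcept_zero (n k : ℕ) :
    chainCount (n + 1) k (fullExcept 0) = chainCount n k fun _ => true := by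
  rw [chainCount, fullExcept_zero, partition_cons_false]
  simp [chainCount, weightA_unit]
  simp [unitParam]
  rfl

/-- The generating polynomial `∑ A_{n,k} t ^ (k - 1)`, where the column `k : Fin n` is counted
from `0`. -/
noncomputable def refinedPoly (n : ℕ) (t : ℝ) : ℝ :=
  ∑ k : Fin n, t ^ (k : ℕ) * chainCount n (n - 1) (fullExcept k)

/-- If only the bottom row has a free parameter `(X, 1)`, then the partition function is the
generating polynomial at the weight `X + 1` of a vertical crossing. -/
theorem partition_refined (n : ℕ) (X : ℝ) :
    partition (fun _ : Fin (n + 1) => unitParam) ((X, 1) :: List.replicate n unitParam)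
      (fun _ => true) = refinedPoly (n + 1) (X + 1) := by
  rw [partition_full]
  simp [refinedPoly, chainCount]

theorem refinedPoly_one (n : ℕ) :
    refinedPoly (n + 1) 1 = chainCount (n + 1) (n + 1) fun _ => true := by
  have := partition_refined n 0
  rw [zero_add] at this
  exact this.symm

theorem chainCount_full_pos (n : ℕ) : 0 < chainCount n n fun _ => true := by
  induction n with
  | zero => simp [chainCount, partition, eq_iff_true_of_subsingleton]
  | succ n ih =>
    rw [← refinedPoly_one, refinedPoly]
    refine lt_of_lt_of_le ih ?_
    rw [← chainCount_fullExcept_zero]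
    have := single_le_sum (f := fun k : Fin (n + 1) => (1 : ℝ) ^ (k : ℕ) *
      chainCount (n + 1) (n + 1 - 1) (fullExcept k)) (fun k _ => by
        simpa using chainCount_nonneg _ _ _) (mem_univ 0)
    simpa using this

theorem refinedPoly_pos (n : ℕ) {t : ℝ} (ht : 1 ≤ t) : 0 < refinedPoly (n + 1) t := by
  have h1 := chainCount_full_pos (n + 1)
  rw [← refinedPoly_one] at h1
  refine lt_of_lt_of_le h1 (sum_le_sum fun k _ => ?_)
  exact mul_le_mul_of_nonneg_right (pow_le_pow_left₀ zero_le_one ht _) (chainCount_nonneg _ _ _)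

/-! ### The three-term relation with homogeneous parameters -/

theorem continuous_rowWeight {n : ℕ} (ys : Fin n → ℝ × ℝ) {f : ℝ → ℝ × ℝ} (hf : Continuous f)
    (h k : Bool) (s t : Fin n → Bool) : Continuous fun ε => rowWeight (f ε) ys h k s t := by
  induction n generalizing h with
  | zero => exact continuous_const
  | succ n ih =>
    simp only [rowWeight]
    refine continuous_finsetSum _ fun m _ => Continuous.mul ?_ (ih _ _ _ _)
    generalize s 0 = a, t 0 = b
    cases h <;> cases m <;> cases a <;> cases b <;>
      simp only [vertexWeight, weightA, weightB, normForm] <;> fun_prop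

theorem continuous_partition {n : ℕ} (ys : Fin n → ℝ × ℝ) (fs : List (ℝ → ℝ × ℝ))
    (hf : ∀ f ∈ fs, Continuous f) (s : Fin n → Bool) :
    Continuous fun ε => partition ys (fs.map fun f => f ε) s := by
  induction fs generalizing s with
  | nil => exact continuous_const
  | cons f fs ih =>
    simp only [List.map_cons, partition]
    exact continuous_finsetSum _ fun t _ =>
      (continuous_rowWeight ys (hf f (by simp)) _ _ _ _).mul
        (ih (fun g hg => hf g (by simp [hg])) t)

theorem continuous_dressed {n : ℕ} (ys : Fin n → ℝ × ℝ) (fs : List (ℝ → ℝ × ℝ))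
    (hf : ∀ f ∈ fs, Continuous f) (x : ℝ × ℝ) :
    Continuous fun ε => dressed ys (fs.map fun f => f ε) x := by
  simp only [dressed]
  refine Continuous.mul (Continuous.mul ?_ continuous_const) ?_
  · simp only [List.map_map]
    refine continuous_list_prod (f := fun g ε => bracket x (g ε)) fs fun g hg => ?_
    have := hf g hg
    simp only [bracket]
    fun_prop
  · exact continuous_partition ys ((fun _ => x) :: fs) (by
      intro f hf'
      rcases List.mem_cons.1 hf' with rfl | h
      · exact continuous_const
      · exact hf f h) _

theorem exists_pos_lower_bound (Xs : List ℝ) (hpos : ∀ Z ∈ Xs, 0 < Z) :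
    ∃ δ > 0, ∀ Z ∈ Xs, δ ≤ Z := by
  induction Xs with
  | nil => exact ⟨1, one_pos, by simp⟩
  | cons Z Xs ih =>
    obtain ⟨δ, hδ, h⟩ := ih fun W hW => hpos W (by simp [hW])
    refine ⟨min Z δ, lt_min (hpos Z (by simp)) hδ, fun W hW => ?_⟩
    rcases List.mem_cons.1 hW with rfl | hW
    · exact min_le_left _ _
    · exact (min_le_right _ _).trans (h W hW)

/-- The three-term relation with all column parameters and `m` row parameters equal to
`unitParam`, as the limit `ε → 0` of the generic relation with row parameters `(ε (j + 1), 1)`. -/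
theorem dressed_three_term_unit (Xs : List ℝ) (m n : ℕ) (hn : Xs.length + m = n)
    {X : ℝ} (hX : 0 < X) (hpos : ∀ Z ∈ Xs, 0 < Z) (hnd : Xs.Nodup) (hmem : X ∉ Xs) :
    let xs := Xs.map (fun Z => ((Z, 1) : ℝ × ℝ)) ++ List.replicate m unitParam
    let D := dressed (fun _ : Fin (n + 1) => unitParam) xs
    D (X, 1) + D (rot (X, 1)) + D (rot (rot (X, 1))) = 0 := by
  intro xs D
  obtain ⟨δ, hδ, hle⟩ := exists_pos_lower_bound (X :: Xs) (by simpa using ⟨hX, hpos⟩)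
  set fs : List (ℝ → ℝ × ℝ) := Xs.map (fun Z _ => (Z, 1)) ++
    (List.range m).map fun (j : ℕ) (ε : ℝ) => (ε * ((j : ℝ) + 1), 1) with hfs
  have hcont : ∀ f ∈ fs, Continuous f := by
    intro f hf
    rcases List.mem_append.1 hf with h | h
    · obtain ⟨Z, -, rfl⟩ := List.mem_map.1 h
      exact continuous_const
    · obtain ⟨j, -, rfl⟩ := List.mem_map.1 h
      fun_prop
  have h0 : fs.map (fun f => f 0) = xs := by
    simp only [hfs, xs, List.map_append, List.map_map, Function.comp_def, zero_mul]
    congr 1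
    rw [List.map_const']
    simp [unitParam]
  set F : ℝ → ℝ := fun ε =>
    dressed (fun _ : Fin (n + 1) => unitParam) (fs.map fun f => f ε) (X, 1) +
    dressed (fun _ : Fin (n + 1) => unitParam) (fs.map fun f => f ε) (rot (X, 1)) +
    dressed (fun _ : Fin (n + 1) => unitParam) (fs.map fun f => f ε) (rot (rot (X, 1))) with hF
  have hFc : Continuous F := ((continuous_dressed _ fs hcont _).add
    (continuous_dressed _ fs hcont _)).add (continuous_dressed _ fs hcont _)
  have hm : (0 : ℝ) < m + 1 := by positivity
  have hzero : ∀ ε ∈ Set.Ioo 0 (δ / (m + 1)), F ε = 0 := by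
    rintro ε ⟨hε0, hε1⟩
    rw [lt_div_iff₀ hm] at hε1
    have hfε : fs.map (fun f => f ε) =
        (Xs ++ (List.range m).map fun j : ℕ => ε * ((j : ℝ) + 1)).map fun Z => (Z, 1) := by
      simp [hfs, Function.comp_def]
    have hlt : ∀ j ∈ List.range m, ε * ((j : ℝ) + 1) < δ := by
      intro j hj
      have : (j : ℝ) < m := by exact_mod_cast List.mem_range.1 hj
      nlinarith
    rw [hF]
    simp only [hfε]
    refine dressed_three_term n _ ?_ _ (fun _ => rfl) hX ?_ ?_ ?_
    · simp [hn]
    · intro Z hZ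
      rcases List.mem_append.1 hZ with h | h
      · exact hpos Z h
      · obtain ⟨j, -, rfl⟩ := List.mem_map.1 h
        positivity
    · refine hnd.append ?_ ?_
      · refine List.nodup_range.map fun a b hab => ?_
        have := mul_left_cancel₀ hε0.ne' hab
        exact_mod_cast add_right_cancel this
      · intro Z hZ hZ'
        obtain ⟨j, hj, rfl⟩ := List.mem_map.1 hZ'
        exact absurd (hle _ (by simp [hZ])) (not_le.2 (hlt j hj))
    · intro hZ
      rcases List.mem_append.1 hZ with h | h
      · exact hmem h
      · obtain ⟨j, hj, h⟩ := List.mem_map.1 h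
        exact absurd (hle X (by simp)) (not_le.2 (h ▸ hlt j hj))
  have hcl : F 0 = 0 := by
    have hclosed : IsClosed {ε | F ε = 0} := isClosed_eq hFc continuous_const
    have hsub := hclosed.closure_subset_iff.2 hzero
    rw [closure_Ioo (by positivity)] at hsub
    exact hsub ⟨le_rfl, by positivity⟩
  simpa [hF, h0] using hcl

theorem partition_smul (c : ℝ) (x : ℝ × ℝ) (xs : List (ℝ × ℝ)) (n : ℕ) :
    partition (fun _ : Fin (n + 1) => unitParam) ((c * x.1, c * x.2) :: xs) (fun _ => true) =
      c ^ n * partition (fun _ : Fin (n + 1) => unitParam) (x :: xs) fun _ => true := by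
  rw [partition_full, partition_full, Finset.mul_sum]
  refine sum_congr rfl fun k _ => ?_
  have : c ^ n = c ^ (k : ℕ) * c ^ (n + 1 - 1 - k) := by
    rw [← pow_add]
    congr 1
    omega
  rw [this, ← mul_add, mul_pow, mul_pow]
  ring

theorem dressed_smul (c : ℝ) (x : ℝ × ℝ) (xs : List (ℝ × ℝ)) (n : ℕ) :
    dressed (fun _ : Fin (n + 1) => unitParam) xs (c * x.1, c * x.2) =
      c ^ (xs.length + (n + 1) + n) * dressed (fun _ : Fin (n + 1) => unitParam) xs x := by
  have hb : ∀ y, bracket (c * x.1, c * x.2) y = c * bracket x y := fun y => by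
    simp only [bracket]
    ring
  have hl : (xs.map (bracket (c * x.1, c * x.2))).prod =
      c ^ xs.length * (xs.map (bracket x)).prod := by
    induction xs with
    | nil => simp
    | cons y ys ih =>
      rw [List.map_cons, List.prod_cons, ih, hb, List.map_cons, List.prod_cons, List.length_cons]
      ring
  rw [dressed, dressed, hl, partition_smul, pow_add, pow_add]
  simp only [hb, Finset.prod_mul_distrib, Finset.prod_const, Finset.card_univ, Fintype.card_fin]
  ring

/-- The three-term relation in terms of the affine coordinate of the bottom row: by homogeneity, the
rotations of `(X, 1)` are replaced by the multiples `(1 / (-X - 1), 1)` and `((-X - 1) / X, 1)`. -/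
theorem dressed_three_term_affine (Xs : List ℝ) (m n : ℕ) (hn : Xs.length + m = n)
    {X : ℝ} (hX : 0 < X) (hpos : ∀ Z ∈ Xs, 0 < Z) (hnd : Xs.Nodup) (hmem : X ∉ Xs) (g : ℝ → ℝ)
    (hg : ∀ t, g t = dressed (fun _ : Fin (n + 1) => unitParam)
      (Xs.map (fun Z => ((Z, 1) : ℝ × ℝ)) ++ List.replicate m unitParam) (t, 1)) :
    g X + (-X - 1) ^ (3 * (n + 1) - 2) * g (1 / (-X - 1)) +
      X ^ (3 * (n + 1) - 2) * g ((-X - 1) / X) = 0 := by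
  have h := dressed_three_term_unit Xs m n hn hX hpos hnd hmem
  have hne : -X - 1 ≠ 0 := by linarith
  have hr : rot (X, 1) = ((-X - 1) * (1 / (-X - 1)), (-X - 1) * 1) := by
    rw [mul_one_div_cancel hne, mul_one]
    rfl
  have hrr : rot (rot (X, 1)) = (X * ((-X - 1) / X), X * 1) := by
    rw [mul_div_cancel₀ _ hX.ne', mul_one]
    simp [rot]
    ring
  have hs := fun c s : ℝ => dressed_smul c (s, 1)
    (Xs.map (fun Z => ((Z, 1) : ℝ × ℝ)) ++ List.replicate m unitParam) n
  have hlen : (Xs.map (fun Z => ((Z, 1) : ℝ × ℝ)) ++ List.replicate m unitParam).length = n := by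
    simp [hn]
  rw [hlen, show n + (n + 1) + n = 3 * (n + 1) - 2 by omega] at hs
  dsimp only at h hs
  rwa [hrr, hr, hs, hs, ← hg, ← hg, ← hg] at h

/-! ### Two free row parameters -/

open Polynomial in
theorem natDegree_sum_mul_pow_le (n : ℕ) (c : Fin n → ℝ) :
    (∑ k : Fin n, C (c k) * (X + 1) ^ (k : ℕ)).natDegree ≤ n - 1 := by
  refine natDegree_sum_le_of_forall_le _ _ fun k _ => ?_
  have h1 : (X + 1 : ℝ[X]).natDegree ≤ 1 := by compute_degree
  have h2 := natDegree_pow_le_of_le (k : ℕ) h1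
  have h3 := natDegree_mul_le_of_le (natDegree_C (c k)).le h2
  exact h3.trans (by omega)

/-- The partition function of order `m + 2` with row parameters `(X, 1)` and `(Y, 1)` at the
bottom, all other parameters being homogeneous. -/
noncomputable def twoPoint (m : ℕ) (X Y : ℝ) : ℝ :=
  partition (fun _ : Fin (m + 2) => unitParam) ((X, 1) :: (Y, 1) :: List.replicate m unitParam)
    fun _ => true

open Polynomial in
/-- Three polynomials in `t` satisfy the same three-term relation: that of `twoPoint` times
`t - Y`, that of the generating polynomial of order `m + 2` times `t`, and that of the generating
polynomial of order `m + 1` times `t + 1`. Each comes with a power of `t`, and the factor `t + 1`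
together with one `t` stems from the invariant cubic form `u v (u + v)`. A linear combination of
them has a zero of order two more than the common power of `t`, and so it vanishes. -/
theorem twoPoint_eq (m : ℕ) (t : ℝ) {Y : ℝ} (hY : 0 < Y) :
    chainCount (m + 1) (m + 1) (fun _ => true) * ((t - Y) * twoPoint m t Y) =
      t * refinedPoly (m + 2) (t + 1) * ((Y + 1) * refinedPoly (m + 1) (Y + 1)) -
        Y * refinedPoly (m + 2) (Y + 1) * ((t + 1) * refinedPoly (m + 1) (t + 1)) := by
  -- `p`, `d`, `e` are the three generating functions as polynomials in the free parameter
  set p : ℝ[X] := ∑ k : Fin (m + 2), C (partition (fun _ : Fin (m + 2) => unitParam)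
    ((Y, 1) :: List.replicate m unitParam) (fullExcept k)) * (X + 1) ^ (k : ℕ) with hp
  set d : ℝ[X] := ∑ k : Fin (m + 2), C (chainCount (m + 2) (m + 1) (fullExcept k)) *
    (X + 1) ^ (k : ℕ) with hd
  set e : ℝ[X] := ∑ k : Fin (m + 1), C (chainCount (m + 1) m (fullExcept k)) *
    (X + 1) ^ (k : ℕ) with he
  have hpe : ∀ s, p.eval s = twoPoint m s Y := by
    intro s
    rw [twoPoint, partition_full]
    simp [hp, eval_finsetSum, mul_comm]
  have hde : ∀ s, d.eval s = refinedPoly (m + 2) (s + 1) := by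
    intro s
    simp [hd, eval_finsetSum, refinedPoly, mul_comm]
  have hee : ∀ s, e.eval s = refinedPoly (m + 1) (s + 1) := by
    intro s
    simp [he, eval_finsetSum, refinedPoly, mul_comm]
  have hpdeg : p.natDegree ≤ m + 1 := natDegree_sum_mul_pow_le _ _
  have hddeg : d.natDegree ≤ m + 1 := natDegree_sum_mul_pow_le _ _
  have hedeg : e.natDegree ≤ m := natDegree_sum_mul_pow_le _ _
  have hα := chainCount_full_pos (m + 1)
  set α := chainCount (m + 1) (m + 1) fun _ => true with hαdef
  have hd0 : d.eval 0 ≠ 0 := by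
    rw [hde, zero_add]
    exact (refinedPoly_pos (m + 1) le_rfl).ne'
  have hfY : refinedPoly (m + 2) (Y + 1) ≠ 0 := (refinedPoly_pos (m + 1) (by linarith)).ne'
  have he0 : e.eval 0 = α := by
    rw [hee, zero_add, refinedPoly_one]
  have hp0 : p.eval 0 = refinedPoly (m + 2) (Y + 1) := by
    rw [hpe, twoPoint, partition_swap, ← partition_refined (m + 1) Y]
    · rfl
    · simp [bracket, rot]
  -- `γ` is chosen to make the constant coefficient of `w` vanish, and `β` to make the linear
  -- coefficient vanish
  set γ := -(Y * refinedPoly (m + 2) (Y + 1)) with hγ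
  set q : ℝ[X] := C α * ((X - C Y) * p) - C γ * ((X + 1) * e) with hq
  set β := -q.coeff 1 / d.eval 0 with hβ
  set w : ℝ[X] := q + C β * (X * d) with hw
  have hwe : ∀ s, w.eval s = α * ((s - Y) * twoPoint m s Y) -
      γ * ((s + 1) * refinedPoly (m + 1) (s + 1)) + β * (s * refinedPoly (m + 2) (s + 1)) := by
    intro s
    simp [hw, hq, hpe, hde, hee]
  have hw0 : w.coeff 0 = 0 := by
    rw [coeff_zero_eq_eval_zero]
    simp [hw, hq, he0, hp0, hγ]
    ring
  have hw1 : w.coeff 1 = 0 := by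
    rw [hw, coeff_add, coeff_C_mul, coeff_X_mul, coeff_zero_eq_eval_zero, hβ,
      div_mul_cancel₀ _ hd0]
    ring
  have hwdvd : X ^ 2 ∣ w := by
    rw [X_pow_dvd_iff]
    intro k hk
    interval_cases k
    · exact hw0
    · exact hw1
  have hwdeg : w.natDegree ≤ m + 2 := by
    rw [hw, hq]
    have h1 : ((X - C Y) * p).natDegree ≤ 1 + (m + 1) :=
      natDegree_mul_le_of_le (by compute_degree) hpdeg
    have h2 : ((X + 1 : ℝ[X]) * e).natDegree ≤ 1 + m :=
      natDegree_mul_le_of_le (by compute_degree) hedeg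
    have h3 : ((X : ℝ[X]) * d).natDegree ≤ 1 + (m + 1) :=
      natDegree_mul_le_of_le (by compute_degree) hddeg
    refine (natDegree_add_le _ _).trans (max_le ((natDegree_sub_le _ _).trans (max_le ?_ ?_)) ?_)
    · exact (natDegree_C_mul_le _ _).trans (by omega)
    · exact (natDegree_C_mul_le _ _).trans (by omega)
    · exact (natDegree_C_mul_le _ _).trans (by omega)
  have hzero : X ^ (2 * m + 2) * w = 0 := by
    refine eq_zero_of_three_term (m + 2) (by omega) _ ?_ ?_ (Set.Ioi Y) (Set.Ioi_infinite Y)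
      (fun t ht => hY.trans ht) ?_
    · refine (natDegree_mul_le_of_le (natDegree_X_pow_le _) hwdeg).trans (by omega)
    · rw [show 2 * (m + 2) = 2 * m + 2 + 2 by ring, pow_add _ (2 * m + 2)]
      exact mul_dvd_mul_left _ hwdvd
    · intro t ht
      have ht : Y < t := ht
      have ht0 : 0 < t := hY.trans ht
      have ht1 : -t - 1 ≠ 0 := by linarith
      have hbr : ∀ s : ℝ, bracket (s, 1) unitParam = s := fun s => by simp [bracket, unitParam]
      have r₁ := dressed_three_term_affine [Y] m (m + 1) (by simp [add_comm]) ht0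
        (by simpa using hY) (by simp) (by simpa using ht.ne')
        (fun s => s ^ (2 * m + 2) * ((s - Y) * twoPoint m s Y)) (fun s => by
          simp [dressed, twoPoint, bracket, unitParam]
          ring)
      have r₂ := dressed_three_term_affine [] (m + 1) (m + 1) (by simp) ht0 (by simp) (by simp)
        (by simp) (fun s => s ^ (2 * m + 3) * refinedPoly (m + 2) (s + 1)) (fun s => by
          rw [← partition_refined]
          simp only [dressed, List.map_nil, List.nil_append, List.map_replicate,
            List.prod_replicate, Finset.prod_const, Finset.card_univ, Fintype.card_fin, hbr]
          ring)
      have r₃ := dressed_three_term_affine [] m m (by simp) ht0 (by simp) (by simp)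
        (by simp) (fun s => s ^ (2 * m + 1) * refinedPoly (m + 1) (s + 1)) (fun s => by
          rw [← partition_refined]
          simp only [dressed, List.map_nil, List.nil_append, List.map_replicate,
            List.prod_replicate, Finset.prod_const, Finset.card_univ, Fintype.card_fin, hbr]
          ring)
      have hN : 3 * (m + 1 + 1) - 2 = 3 * (m + 1) - 2 + 3 := by omega
      have hN' : 3 * (m + 2) - 2 = 3 * (m + 1) - 2 + 3 := by omega
      simp only [hN] at r₁ r₂
      rw [hN']
      generalize 3 * (m + 1) - 2 = N at r₁ r₂ r₃ ⊢
      simp only [eval_mul, eval_pow, eval_X, hwe]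
      set s₁ := 1 / (-t - 1) with hs₁
      set s₂ := (-t - 1) / t with hs₂
      -- the cubic form `u v (u + v)` is invariant under the rotation
      have c₁ : (-t - 1) ^ 3 * (s₁ * (s₁ + 1)) = t * (t + 1) := by
        rw [hs₁]
        field_simp
        ring
      have c₂ : t ^ 3 * (s₂ * (s₂ + 1)) = t * (t + 1) := by
        rw [hs₂]
        field_simp
        ring
      simp only [pow_add (-t - 1) N 3, pow_add t N 3] at r₁ r₂ ⊢
      linear_combination α * r₁ + β * r₂ - γ * (t * (t + 1)) * r₃ -
        γ * (-t - 1) ^ N * s₁ ^ (2 * m + 1) * refinedPoly (m + 1) (s₁ + 1) * c₁ -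
        γ * t ^ N * s₂ ^ (2 * m + 1) * refinedPoly (m + 1) (s₂ + 1) * c₂
  have hw : w = 0 := (mul_eq_zero.1 hzero).resolve_left (pow_ne_zero _ X_ne_zero)
  -- the value of `β` results from the zero of `t - Y`
  have hβ' : β = -((Y + 1) * refinedPoly (m + 1) (Y + 1)) := by
    have := hwe Y
    rw [hw, eval_zero, hγ] at this
    have : Y * refinedPoly (m + 2) (Y + 1) * (β + (Y + 1) * refinedPoly (m + 1) (Y + 1)) = 0 := by
      linear_combination -this
    have := (mul_eq_zero.1 this).resolve_left (mul_ne_zero hY.ne' hfY)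
    linarith
  have := hwe t
  rw [hw, eval_zero, hβ', hγ] at this
  linear_combination -this

/-! ### Summation over the two bottom rows -/

/-- The state in which all columns but `i` and `j` are occupied. -/
def fullExceptTwo {n : ℕ} (i j : Fin n) : Fin n → Bool :=
  Function.update (Function.update (fun _ => true) i false) j false

theorem fullExceptTwo_zero_succ {n : ℕ} (j : Fin n) :
    fullExceptTwo 0 j.succ = Fin.cons false (fullExcept j) := by
  funext k
  refine Fin.cases ?_ (fun k => ?_) k
  · simp [fullExceptTwo, (Fin.succ_ne_zero j).symm]
  · simp [fullExceptTwo, fullExcept, Function.update_apply, Fin.succ_inj, Fin.succ_ne_zero]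

theorem fullExceptTwo_succ_succ {n : ℕ} (i j : Fin n) :
    fullExceptTwo i.succ j.succ = Fin.cons true (fullExceptTwo i j) := by
  funext k
  refine Fin.cases ?_ (fun k => ?_) k
  · simp [fullExceptTwo, (Fin.succ_ne_zero j).symm, (Fin.succ_ne_zero i).symm]
  · simp [fullExceptTwo, Function.update_apply, Fin.succ_inj]

/-- The sum of `φ` over the states above two rows with parameters `(X, 1)` (lower) and `(Y, 1)`
(upper), weighted by these rows. The state below is full, the left boundary edges of the rows are
in the states `h₁` and `h₂`, and the right ones are occupied. -/
noncomputable def twoRowSum (X Y : ℝ) {n : ℕ} (h₁ h₂ : Bool) (φ : (Fin n → Bool) → ℝ) : ℝ :=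
  ∑ r, ∑ t, rowWeight (X, 1) (fun _ => unitParam) h₁ true (fun _ => true) r *
    rowWeight (Y, 1) (fun _ => unitParam) h₂ true r t * φ t

section
variable (X Y : ℝ) {n : ℕ}

theorem twoRowSum_true_true (φ : (Fin n → Bool) → ℝ) :
    twoRowSum X Y true true φ = φ fun _ => true := by
  simp [twoRowSum, rowWeight_true_true_full, weightA_unit]

theorem twoRowSum_true_false (φ : (Fin n → Bool) → ℝ) :
    twoRowSum X Y true false φ = ∑ k : Fin n, (Y + 1) ^ (k : ℕ) * φ (fullExcept k) := by
  have : twoRowSum X Y true false φ = ∑ t, rowWeight (Y, 1) (fun _ => unitParam) false true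
      (fun _ => true) t * φ t := by
    simp [twoRowSum, rowWeight_true_true_full, weightA_unit]
  rw [this, sum_rowWeight_full]
  simp

theorem tail_unitParam : Fin.tail (fun _ : Fin (n + 1) => unitParam) = fun _ => unitParam := rfl

theorem twoRowSum_false_true_succ (φ : (Fin (n + 1) → Bool) → ℝ) :
    twoRowSum X Y false true φ =
      (X + 1) * twoRowSum X Y false true (fun t => φ (Fin.cons true t)) +
        (Y + 1) * twoRowSum X Y true true (fun t => φ (Fin.cons false t)) +
        (Y ^ 2 + Y + 1) * twoRowSum X Y true false (fun t => φ (Fin.cons true t)) := by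
  simp only [twoRowSum, sum_state_succ, Fintype.sum_bool, rowWeight, Fin.cons_zero, Fin.tail_cons,
    tail_const, tail_unitParam, vertexWeight, weightA_unit, weightB_unit, zero_mul, mul_zero,
    add_zero, zero_add, one_mul, Finset.mul_sum, ← Finset.sum_add_distrib]
  refine sum_congr rfl fun r _ => sum_congr rfl fun t _ => ?_
  simp only [normForm, unitParam]
  ring

theorem twoRowSum_false_false_succ (φ : (Fin (n + 1) → Bool) → ℝ) :
    twoRowSum X Y false false φ =
      (X + 1) * (Y + 1) * twoRowSum X Y false false (fun t => φ (Fin.cons true t)) +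
        (X + 1) * twoRowSum X Y false true (fun t => φ (Fin.cons false t)) +
        twoRowSum X Y true false (fun t => φ (Fin.cons false t)) := by
  simp only [twoRowSum, sum_state_succ, Fintype.sum_bool, rowWeight, Fin.cons_zero, Fin.tail_cons,
    tail_const, tail_unitParam, vertexWeight, weightA_unit, weightB_unit, zero_mul, mul_zero,
    add_zero, zero_add, one_mul, Finset.mul_sum, ← Finset.sum_add_distrib]
  refine sum_congr rfl fun r _ => sum_congr rfl fun t _ => ?_
  ring

theorem twoRowSum_false_true (φ : (Fin n → Bool) → ℝ) :
    (Y - X) * twoRowSum X Y false true φ =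
      ∑ k : Fin n, ((Y + 1) ^ (k : ℕ) * (Y ^ 2 + Y + 1) -
        (X + 1) ^ (k : ℕ) * (1 - (Y + 1) + (X + 1) * (Y + 1))) * φ (fullExcept k) := by
  induction n with
  | zero => simp [twoRowSum, rowWeight]
  | succ n ih =>
    rw [twoRowSum_false_true_succ, Fin.sum_univ_succ, twoRowSum_true_true, twoRowSum_true_false,
      fullExcept_zero]
    simp only [fullExcept_succ, Fin.val_zero, Fin.val_succ, pow_zero]
    have h := ih fun t => φ (Fin.cons true t)
    calc _ = (X + 1) * ((Y - X) * twoRowSum X Y false true fun t => φ (Fin.cons true t)) +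
          (Y - X) * ((Y + 1) * φ (Fin.cons false fun _ => true)) +
          (Y - X) * (Y ^ 2 + Y + 1) *
            ∑ k : Fin n, (Y + 1) ^ (k : ℕ) * φ (Fin.cons true (fullExcept k)) := by ring
      _ = (Y - X) * ((Y + 1) * φ (Fin.cons false fun _ => true)) +
          ∑ k : Fin n, ((X + 1) * ((Y + 1) ^ (k : ℕ) * (Y ^ 2 + Y + 1) -
            (X + 1) ^ (k : ℕ) * (1 - (Y + 1) + (X + 1) * (Y + 1))) +
            (Y - X) * (Y ^ 2 + Y + 1) * (Y + 1) ^ (k : ℕ)) *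
              φ (Fin.cons true (fullExcept k)) := by
        rw [h, Finset.mul_sum, Finset.mul_sum, add_right_comm, ← Finset.sum_add_distrib, add_comm]
        congr 1
        exact sum_congr rfl fun k _ => by ring
      _ = _ := by
        congr 1
        · ring
        · refine sum_congr rfl fun k _ => ?_
          ring

/-- The doubly refined counts appear here: over a full state, two rows with empty left boundary
empty exactly two columns `i < j`. -/
theorem twoRowSum_false_false (φ : (Fin n → Bool) → ℝ) :
    (Y - X) * twoRowSum X Y false false φ =
      ∑ i : Fin n, ∑ j : Fin n, if i < j then
        ((X + 1) ^ (i : ℕ) * (Y + 1) ^ (j : ℕ) * (1 - (X + 1) + (X + 1) * (Y + 1)) -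
          (X + 1) ^ (j : ℕ) * (Y + 1) ^ (i : ℕ) * (1 - (Y + 1) + (X + 1) * (Y + 1))) *
            φ (fullExceptTwo i j) else 0 := by
  induction n with
  | zero => simp [twoRowSum, rowWeight]
  | succ n ih =>
    rw [twoRowSum_false_false_succ, Fin.sum_univ_succ, Fin.sum_univ_succ, twoRowSum_true_false]
    have h := ih fun t => φ (Fin.cons true t)
    have h' := twoRowSum_false_true X Y fun t : Fin n → Bool => φ (Fin.cons false t)
    simp only [Fin.sum_univ_succ (fun j : Fin (n + 1) => ite (Fin.succ _ < j) _ _),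
      Fin.succ_pos, Fin.not_lt_zero, Fin.succ_lt_succ_iff, if_true, if_false, zero_add,
      fullExceptTwo_zero_succ, fullExceptTwo_succ_succ, Fin.val_zero, Fin.val_succ, pow_zero,
      lt_self_iff_false]
    calc _ = (X + 1) * ((Y - X) * twoRowSum X Y false true fun t => φ (Fin.cons false t)) +
          (Y - X) * (∑ k : Fin n, (Y + 1) ^ (k : ℕ) * φ (Fin.cons false (fullExcept k))) +
          (X + 1) * (Y + 1) *
            ((Y - X) * twoRowSum X Y false false fun t => φ (Fin.cons true t)) := by ring
      _ = _ := by
        rw [h, h']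
        simp only [Finset.mul_sum]
        rw [← Finset.sum_add_distrib]
        congr 1
        · refine sum_congr rfl fun k _ => ?_
          ring
        · refine sum_congr rfl fun i _ => sum_congr rfl fun j _ => ?_
          split_ifs
          · ring
          · ring

end

theorem twoPoint_eq_twoRowSum (m : ℕ) (X Y : ℝ) :
    twoPoint m X Y = twoRowSum X Y false false (chainCount (m + 2) m) := by
  simp only [twoPoint, partition, twoRowSum, chainCount, Finset.mul_sum, mul_assoc]

/-! ### The recursion for the doubly refined numbers -/

/-- The number `A_{n,k}` as a count of chains; `k` is counted from `1`, and the value is `0`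
outside of `[1, n]`. -/
noncomputable def refinedCount (n k : ℕ) : ℝ :=
  if h : 1 ≤ k ∧ k ≤ n then chainCount n (n - 1) (fullExcept ⟨k - 1, by omega⟩) else 0

/-- The number `A_{n,i,j}` as a count of chains; `i` and `j` are counted from `1`, and the value is
`0` unless `1 ≤ i < j ≤ n`. -/
noncomputable def doublyRefinedCount (n i j : ℕ) : ℝ :=
  if h : 1 ≤ i ∧ i < j ∧ j ≤ n then
    chainCount n (n - 2) (fullExceptTwo ⟨i - 1, by omega⟩ ⟨j - 1, by omega⟩) else 0

theorem sum_range_shift {n : ℕ} {g : ℕ → ℝ} (t : ℝ) (h0 : g 0 = 0) (hn : g (n + 1) = 0) :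
    t * ∑ s ∈ range (n + 1), g (s + 1) * t ^ s = ∑ s ∈ range (n + 1), g s * t ^ s := by
  rw [Finset.sum_range_succ, hn, zero_mul, add_zero, Finset.sum_range_succ', h0, zero_mul, add_zero,
    Finset.mul_sum]
  exact sum_congr rfl fun s _ => by ring

theorem refinedPoly_eq (n N : ℕ) (hN : n ≤ N) (t : ℝ) :
    refinedPoly n t = ∑ s ∈ range (N + 1), refinedCount n (s + 1) * t ^ s := by
  have h1 : ∑ s ∈ range (N + 1), refinedCount n (s + 1) * t ^ s =
      ∑ s ∈ range n, refinedCount n (s + 1) * t ^ s := by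
    symm
    refine sum_subset (by simpa using by omega) fun s _ hs => ?_
    rw [Finset.mem_range, not_lt] at hs
    rw [refinedCount, dif_neg (by omega), zero_mul]
  rw [h1, ← Fin.sum_univ_eq_sum_range (fun s => refinedCount n (s + 1) * t ^ s), refinedPoly]
  refine sum_congr rfl fun k _ => ?_
  have hk := k.2
  rw [refinedCount, dif_pos (by omega), mul_comm]
  rfl

theorem eq_zero_of_sum_pow {N : ℕ} (c : ℕ → ℝ) (h : ∀ t > 1, ∑ s ∈ range N, c s * t ^ s = 0)
    {s : ℕ} (hs : s < N) : c s = 0 := by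
  have : (∑ s ∈ range N, Polynomial.C (c s) * Polynomial.X ^ s) = 0 := by
    refine Polynomial.eq_zero_of_infinite_isRoot _ ((Set.Ioi_infinite (1 : ℝ)).mono fun t ht => ?_)
    simpa [Polynomial.IsRoot.def, Polynomial.eval_finsetSum] using h t ht
  have := congrArg (fun p => Polynomial.coeff p s) this
  simpa [Polynomial.finsetSum_coeff, Polynomial.coeff_X_pow, hs] using this

theorem eq_zero_of_sum_pow_pow {N : ℕ} (c : ℕ → ℕ → ℝ)
    (h : ∀ t > 1, ∀ u > 1, ∑ s ∈ range N, ∑ r ∈ range N, c s r * t ^ s * u ^ r = 0)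
    {s r : ℕ} (hs : s < N) (hr : r < N) : c s r = 0 := by
  refine eq_zero_of_sum_pow (c s) (fun u hu => ?_) hr
  refine eq_zero_of_sum_pow (fun s => ∑ r ∈ range N, c s r * u ^ r) (fun t ht => ?_) hs
  rw [← h t ht u hu]
  refine sum_congr rfl fun s _ => ?_
  rw [Finset.sum_mul]
  exact sum_congr rfl fun r _ => by ring

theorem sum_doublyRefined (n : ℕ) (t u : ℝ) :
    ∑ i : Fin n, ∑ j : Fin n, (if i < j then t ^ (i : ℕ) * u ^ (j : ℕ) *
        chainCount n (n - 2) (fullExceptTwo i j) else 0) =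
      ∑ s ∈ range (n + 1), ∑ r ∈ range (n + 1),
        doublyRefinedCount n (s + 1) (r + 1) * t ^ s * u ^ r := by
  have h0 : ∀ s r, ¬ (s < r ∧ r < n) → doublyRefinedCount n (s + 1) (r + 1) = 0 := by
    intro s r h
    rw [doublyRefinedCount, dif_neg (by omega)]
  rw [Finset.sum_range_succ, Finset.sum_eq_zero (s := range (n + 1)) (fun r hr => by
    rw [h0 _ _ (by have := Finset.mem_range.1 hr; omega)]; ring), add_zero]
  have hlast : ∀ s, doublyRefinedCount n (s + 1) (n + 1) = 0 := fun s => h0 s n (by omega)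
  simp only [Finset.sum_range_succ _ n, hlast, zero_mul, add_zero]
  rw [← Fin.sum_univ_eq_sum_range (fun s => ∑ r ∈ range n,
    doublyRefinedCount n (s + 1) (r + 1) * t ^ s * u ^ r)]
  refine sum_congr rfl fun i _ => ?_
  rw [← Fin.sum_univ_eq_sum_range (fun r =>
    doublyRefinedCount n (i + 1) (r + 1) * t ^ (i : ℕ) * u ^ r)]
  refine sum_congr rfl fun j _ => ?_
  have hi := i.2
  have hj := j.2
  split_ifs with h
  · rw [doublyRefinedCount, dif_pos (by have : (i : ℕ) < j := h; omega)]
    simp only [Nat.add_sub_cancel, Fin.eta]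
    ring
  · rw [h0 _ _ (fun h' => h h'.1)]
    ring

/-- The coefficients of `twoPoint_eq` at `t ^ s * u ^ r`, where `t = X + 1` and `u = Y + 1`. The
function `(u - t) * Z` is the difference of a polynomial and its reflection in `t` and `u`;
for `s < r`, only the polynomial itself has a coefficient there. -/
theorem doublyRefinedCount_recursion (m s r : ℕ) (hsr : s < r) (hr : r ≤ m + 2) :
    chainCount (m + 1) (m + 1) (fun _ => true) *
        (doublyRefinedCount (m + 2) s r - doublyRefinedCount (m + 2) s (r + 1) +
          doublyRefinedCount (m + 2) (s + 1) (r + 1)) =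
      refinedCount (m + 1) r * (refinedCount (m + 2) (s + 1) - refinedCount (m + 2) s) -
        refinedCount (m + 1) s * (refinedCount (m + 2) (r + 1) - refinedCount (m + 2) r) := by
  set α := chainCount (m + 1) (m + 1) fun _ => true
  set A := doublyRefinedCount (m + 2) with hA
  set B := refinedCount (m + 2) with hB
  set E := refinedCount (m + 1) with hE
  set N := m + 3 with hN
  have hB0 : B 0 = 0 := by rw [hB, refinedCount, dif_neg (by omega)]
  have hBN : B N = 0 := by rw [hB, refinedCount, dif_neg (by omega)]
  have hE0 : E 0 = 0 := by rw [hE, refinedCount, dif_neg (by omega)]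
  have hEN : E N = 0 := by rw [hE, refinedCount, dif_neg (by omega)]
  have hA0 : ∀ i j, ¬ (1 ≤ i ∧ i < j ∧ j ≤ m + 2) → A i j = 0 := by
    intro i j h
    rw [hA, doublyRefinedCount, dif_neg h]
  have hf : ∀ t, refinedPoly (m + 2) t = ∑ s ∈ range N, B (s + 1) * t ^ s := fun t =>
    refinedPoly_eq (m + 2) (m + 2) le_rfl t
  have hf' : ∀ t, t * refinedPoly (m + 2) t = ∑ s ∈ range N, B s * t ^ s := fun t => by
    rw [hf, sum_range_shift t hB0 hBN]
  have he' : ∀ t, t * refinedPoly (m + 1) t = ∑ s ∈ range N, E s * t ^ s := fun t => by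
    rw [refinedPoly_eq (m + 1) (m + 2) (by omega) t, sum_range_shift t hE0 hEN]
  have hg : ∀ t, (t - 1) * refinedPoly (m + 2) t =
      ∑ s ∈ range N, (B s - B (s + 1)) * t ^ s := fun t => by
    rw [sub_mul, one_mul, hf', hf, ← Finset.sum_sub_distrib]
    exact sum_congr rfl fun s _ => by ring
  have hD : ∀ t u : ℝ, (1 - t + t * u) * ∑ i : Fin (m + 2), ∑ j : Fin (m + 2),
      (if i < j then t ^ (i : ℕ) * u ^ (j : ℕ) *
        chainCount (m + 2) m (fullExceptTwo i j) else 0) =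
      ∑ s ∈ range N, ∑ r ∈ range N, (A (s + 1) (r + 1) - A s (r + 1) + A s r) * t ^ s * u ^ r := by
    intro t u
    have e0 := sum_doublyRefined (m + 2) t u
    simp only [Nat.add_sub_cancel] at e0
    rw [e0, ← hA]
    have e1 : t * ∑ s ∈ range N, ∑ r ∈ range N, A (s + 1) (r + 1) * t ^ s * u ^ r =
        ∑ s ∈ range N, ∑ r ∈ range N, A s (r + 1) * t ^ s * u ^ r := by
      have := sum_range_shift (n := m + 2) (g := fun s => ∑ r ∈ range N, A s (r + 1) * u ^ r) t
        (sum_eq_zero fun r _ => by rw [hA0 _ _ (by omega), zero_mul])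
        (sum_eq_zero fun r _ => by rw [hA0 _ _ (by omega), zero_mul])
      simp only [Finset.sum_mul] at this
      have hc : ∀ a b c : ℝ, a * b * c = a * c * b := fun a b c => by ring
      simpa only [hc _ (u ^ _) (t ^ _)] using this
    have e2 : u * ∑ s ∈ range N, ∑ r ∈ range N, A s (r + 1) * t ^ s * u ^ r =
        ∑ s ∈ range N, ∑ r ∈ range N, A s r * t ^ s * u ^ r := by
      rw [Finset.mul_sum]
      refine sum_congr rfl fun s _ => ?_
      exact sum_range_shift (n := m + 2) (g := fun r => A s r * t ^ s) u
        (by rw [hA0 _ _ (by omega), zero_mul]) (by rw [hA0 _ _ (by omega), zero_mul])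
    calc _ = (∑ s ∈ range N, ∑ r ∈ range N, A (s + 1) (r + 1) * t ^ s * u ^ r) -
          t * (∑ s ∈ range N, ∑ r ∈ range N, A (s + 1) (r + 1) * t ^ s * u ^ r) +
          u * (t * ∑ s ∈ range N, ∑ r ∈ range N, A (s + 1) (r + 1) * t ^ s * u ^ r) := by ring
      _ = _ := by
        rw [e1, e2]
        simp only [← Finset.sum_sub_distrib, ← Finset.sum_add_distrib]
        exact sum_congr rfl fun s _ => sum_congr rfl fun r _ => by ring
  have key : ∀ t > 1, ∀ u > 1, ∑ s ∈ range N, ∑ r ∈ range N,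
      (α * (A (s + 1) (r + 1) - A s (r + 1) + A s r - (A (r + 1) (s + 1) - A r (s + 1) + A r s)) +
        ((B s - B (s + 1)) * E r - (B r - B (r + 1)) * E s)) * t ^ s * u ^ r = 0 := by
    intro t ht u hu
    have h1 := twoPoint_eq m (t - 1) (Y := u - 1) (by linarith)
    have h2 := twoRowSum_false_false (t - 1) (u - 1) (chainCount (m + 2) m)
    rw [← twoPoint_eq_twoRowSum] at h2
    simp only [sub_add_cancel] at h1 h2
    have h3 := hD t u
    have h4 := hD u t
    have h5 : ∑ i : Fin (m + 2), ∑ j : Fin (m + 2), (if i < j then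
        (t ^ (i : ℕ) * u ^ (j : ℕ) * (1 - t + t * u) -
          t ^ (j : ℕ) * u ^ (i : ℕ) * (1 - u + t * u)) *
            chainCount (m + 2) m (fullExceptTwo i j) else 0) =
        (1 - t + t * u) * ∑ i : Fin (m + 2), ∑ j : Fin (m + 2),
          (if i < j then t ^ (i : ℕ) * u ^ (j : ℕ) *
            chainCount (m + 2) m (fullExceptTwo i j) else 0) -
        (1 - u + u * t) * ∑ i : Fin (m + 2), ∑ j : Fin (m + 2),
          (if i < j then u ^ (i : ℕ) * t ^ (j : ℕ) *
            chainCount (m + 2) m (fullExceptTwo i j) else 0) := by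
      simp only [Finset.mul_sum, ← Finset.sum_sub_distrib]
      refine sum_congr rfl fun i _ => sum_congr rfl fun j _ => ?_
      split_ifs <;> ring
    rw [h5, h3, h4] at h2
    have h6 : (t - 1) * refinedPoly (m + 2) t * (u * refinedPoly (m + 1) u) =
        ∑ s ∈ range N, ∑ r ∈ range N, (B s - B (s + 1)) * E r * t ^ s * u ^ r := by
      rw [hg, he', Finset.sum_mul_sum]
      exact sum_congr rfl fun s _ => sum_congr rfl fun r _ => by ring
    have h7 : (u - 1) * refinedPoly (m + 2) u * (t * refinedPoly (m + 1) t) =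
        ∑ s ∈ range N, ∑ r ∈ range N, (B r - B (r + 1)) * E s * t ^ s * u ^ r := by
      rw [hg, he', mul_comm, Finset.sum_mul_sum]
      exact sum_congr rfl fun s _ => sum_congr rfl fun r _ => by ring
    have h8 : ∑ s ∈ range N, ∑ r ∈ range N, (A (s + 1) (r + 1) - A s (r + 1) + A s r) *
        u ^ s * t ^ r =
        ∑ s ∈ range N, ∑ r ∈ range N, (A (r + 1) (s + 1) - A r (s + 1) + A r s) *
          t ^ s * u ^ r := by
      rw [Finset.sum_comm]
      exact sum_congr rfl fun s _ => sum_congr rfl fun r _ => by ring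
    rw [h6, h7] at h1
    rw [h8] at h2
    have h9 : ∑ s ∈ range N, ∑ r ∈ range N,
      (α * (A (s + 1) (r + 1) - A s (r + 1) + A s r - (A (r + 1) (s + 1) - A r (s + 1) + A r s)) +
        ((B s - B (s + 1)) * E r - (B r - B (r + 1)) * E s)) * t ^ s * u ^ r =
        α * ((∑ s ∈ range N, ∑ r ∈ range N, (A (s + 1) (r + 1) - A s (r + 1) + A s r) *
          t ^ s * u ^ r) - ∑ s ∈ range N, ∑ r ∈ range N,
            (A (r + 1) (s + 1) - A r (s + 1) + A r s) * t ^ s * u ^ r) +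
        ((∑ s ∈ range N, ∑ r ∈ range N, (B s - B (s + 1)) * E r * t ^ s * u ^ r) -
          ∑ s ∈ range N, ∑ r ∈ range N, (B r - B (r + 1)) * E s * t ^ s * u ^ r) := by
      simp only [← Finset.sum_sub_distrib, Finset.mul_sum, ← Finset.sum_add_distrib]
      exact sum_congr rfl fun s _ => sum_congr rfl fun r _ => by ring
    rw [h9, ← h2, ← h1]
    ring
  have := eq_zero_of_sum_pow_pow _ key (s := s) (r := r) (by omega) (by omega)
  rw [hA0 (r + 1) (s + 1) (by omega), hA0 r (s + 1) (by omega), hA0 r s (by omega)] at this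
  linear_combination this

/-- Inversion of the recursion: with the recursion inserted, the sum over `q` becomes the
difference of the values of `∑ q, (-1) ^ q * p.choose q * A (i + q) (j + p)` at `p` and `p + 1`,
by Pascal's rule, and the sum over `p` telescopes. -/
theorem sum_choose_eq {n i j : ℕ} (hj : j ≤ n) (A X : ℕ → ℕ → ℚ)
    (h0 : ∀ a b, n < b → A a b = 0)
    (hX : ∀ a b, i ≤ a → a < b → b ≤ n → X a b = A a b - A a (b + 1) + A (a + 1) (b + 1))
    (hij : i < j) :
    ∑ p ∈ range (n - j + 1), ∑ q ∈ range (p + 1),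
      (-1 : ℚ) ^ q * (p.choose q : ℚ) * X (i + q) (j + p) = A i j := by
  set Y : ℕ → ℚ := fun p => ∑ q ∈ range (p + 1), (-1 : ℚ) ^ q * (p.choose q : ℚ) *
    A (i + q) (j + p) with hY
  have step : ∀ p ∈ range (n - j + 1), ∑ q ∈ range (p + 1),
      (-1 : ℚ) ^ q * (p.choose q : ℚ) * X (i + q) (j + p) = Y p - Y (p + 1) := by
    intro p hp
    have hp' := Finset.mem_range.1 hp
    have h1 : Y (p + 1) = ∑ q ∈ range (p + 1), (-1 : ℚ) ^ q * (p.choose q : ℚ) *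
        (A (i + q) (j + p + 1) - A (i + q + 1) (j + p + 1)) := by
      have e1 : Y (p + 1) = ∑ q ∈ range (p + 1), ((-1 : ℚ) ^ (q + 1) * (p.choose q : ℚ) *
          A (i + q + 1) (j + p + 1)) + (∑ q ∈ range (p + 1), ((-1 : ℚ) ^ (q + 1) *
            (p.choose (q + 1) : ℚ) * A (i + (q + 1)) (j + p + 1)) + A i (j + p + 1)) := by
        simp only [hY]
        rw [Finset.sum_range_succ', ← add_assoc (Finset.sum _ _), ← Finset.sum_add_distrib]
        congr 1
        · refine sum_congr rfl fun q _ => ?_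
          rw [Nat.choose_succ_succ']
          push_cast
          ring_nf
        · simp [add_assoc]
      have e2 : ∑ q ∈ range (p + 1), ((-1 : ℚ) ^ (q + 1) * (p.choose (q + 1) : ℚ) *
          A (i + (q + 1)) (j + p + 1)) + A i (j + p + 1) =
          ∑ q ∈ range (p + 1), (-1 : ℚ) ^ q * (p.choose q : ℚ) * A (i + q) (j + p + 1) := by
        have := Finset.sum_range_succ' (fun q => (-1 : ℚ) ^ q * (p.choose q : ℚ) *
          A (i + q) (j + p + 1)) (p + 1)
        rw [Finset.sum_range_succ, Nat.choose_succ_self] at this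
        simpa using this.symm
      rw [e1, e2, ← Finset.sum_add_distrib]
      exact sum_congr rfl fun q _ => by ring
    rw [h1]
    simp only [hY]
    rw [← Finset.sum_sub_distrib]
    refine sum_congr rfl fun q hq => ?_
    have hq' := Finset.mem_range.1 hq
    rw [hX (i + q) (j + p) (by omega) (by omega) (by omega)]
    ring
  rw [sum_congr rfl step, Finset.sum_range_sub']
  have hlast : Y (n - j + 1) = 0 := by
    simp only [hY]
    exact sum_eq_zero fun q _ => by rw [h0 _ _ (by omega), mul_zero]
  rw [hlast]
  simp [hY]

/-! ### Alternating sign vectors -/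

/-- The sum of the entries of `v` up to and including the position `c`. -/
def prefixSum {n : ℕ} (v : Fin n → ℤ) (c : Fin n) : ℤ := ∑ a, if a ≤ c then v a else 0

theorem prefixSum_cons_zero {n : ℕ} (x : ℤ) (v : Fin n → ℤ) :
    prefixSum (Fin.cons x v : Fin (n + 1) → ℤ) 0 = x := by
  simp [prefixSum]

theorem prefixSum_cons_succ {n : ℕ} (x : ℤ) (v : Fin n → ℤ) (c : Fin n) :
    prefixSum (Fin.cons x v : Fin (n + 1) → ℤ) c.succ = x + prefixSum v c := by
  simp [prefixSum, Fin.sum_univ_succ]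

theorem prefixSum_eq_strict_add {n : ℕ} (v : Fin n → ℤ) (c : Fin n) :
    prefixSum v c = (∑ a, if a < c then v a else 0) + v c := by
  have : v c = ∑ a, if a = c then v a else 0 := by simp
  rw [prefixSum, this, ← Finset.sum_add_distrib]
  refine sum_congr rfl fun a _ => ?_
  rcases lt_trichotomy a c with h | h | h
  · simp [h, h.le, h.ne]
  · simp [h]
  · simp [h.not_ge, h.not_gt, h.ne']

theorem strictPrefix_eq {n : ℕ} (v : Fin n → ℤ) (c : Fin n) :
    (∑ a, if a < c then v a else 0) = 0 ∨
      ∃ d, (∑ a, if a < c then v a else 0) = prefixSum v d := by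
  rcases Nat.eq_zero_or_pos (c : ℕ) with h | h
  · left
    refine sum_eq_zero fun a _ => if_neg ?_
    rw [Fin.lt_def]
    omega
  · right
    refine ⟨⟨c - 1, by omega⟩, ?_⟩
    rw [prefixSum]
    refine sum_congr rfl fun a _ => ?_
    congr 1
    rw [Fin.lt_def, Fin.le_def]
    simp only [eq_iff_iff]
    omega

/-- All prefix sums of `v` are `0` or `1`. -/
def PrefixBounded {n : ℕ} (v : Fin n → ℤ) : Prop := ∀ c, prefixSum v c = 0 ∨ prefixSum v c = 1

theorem isAlternatingSignVector_of_prefixBounded {n : ℕ} {v : Fin n → ℤ} (h : PrefixBounded v)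
    (hs : ∑ a, v a = 1) : IsAlternatingSignVector v := by
  have hstrict : ∀ c, (∑ a, if a < c then v a else 0) = 0 ∨
      (∑ a, if a < c then v a else 0) = 1 := by
    intro c
    rcases strictPrefix_eq v c with h0 | ⟨d, hd⟩
    · exact Or.inl h0
    · rw [hd]
      exact h d
  have hentry : ∀ a, v a = -1 ∨ v a = 0 ∨ v a = 1 := by
    intro a
    have := prefixSum_eq_strict_add v a
    have := h a
    have := hstrict a
    omega
  refine ⟨hentry, hs, fun a b hab ha hb hz => ?_⟩
  have key : (∑ c, if c < b then v c else 0) = prefixSum v a := by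
    refine sum_congr rfl fun c _ => ?_
    rcases le_or_gt c a with hc | hc
    · simp [hc, hc.trans_lt hab]
    · simp only [hc.not_ge, if_false]
      split_ifs with hcb
      · exact hz c hc hcb
      · rfl
  have h1 := prefixSum_eq_strict_add v a
  have h2 := prefixSum_eq_strict_add v b
  have := hentry a
  have := hentry b
  have := h a
  have := h b
  have := hstrict a
  omega

/-- If the nonzero entries of `v` are signs and alternate, then every prefix sum is `0` or the first
nonzero entry `ε`. -/
theorem exists_sign_of_alternating {n : ℕ} (v : Fin n → ℤ)
    (h : ∀ a, v a = -1 ∨ v a = 0 ∨ v a = 1)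
    (halt : ∀ a b : Fin n, a < b → v a ≠ 0 → v b ≠ 0 → (∀ c, a < c → c < b → v c = 0) →
      v a = -v b) :
    ∃ ε : ℤ, (ε = 1 ∨ ε = -1) ∧ (∀ c, prefixSum v c = 0 ∨ prefixSum v c = ε) ∧
      ∀ a, v a ≠ 0 → (∀ c < a, v c = 0) → v a = ε := by
  induction n with
  | zero => exact ⟨1, Or.inl rfl, fun c => c.elim0, fun c => c.elim0⟩
  | succ n ih =>
    induction v using Fin.consCases with
    | _ x v =>
    obtain ⟨ε, hε, hpre, hfirst⟩ := ih v (fun a => by simpa using h a.succ)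
        fun a b hab ha hb hc => by
      simpa using halt a.succ b.succ (by simpa using hab) (by simpa using ha) (by simpa using hb)
        fun c hac hcb => by
          induction c using Fin.cases with
          | zero => simp at hac
          | succ c => simpa using hc c (by simpa using hac) (by simpa using hcb)
    rcases eq_or_ne x 0 with rfl | hx
    · refine ⟨ε, hε, fun c => ?_, fun a ha hc => ?_⟩
      · induction c using Fin.cases with
        | zero => exact Or.inl (prefixSum_cons_zero _ _)
        | succ c => simpa [prefixSum_cons_succ] using hpre c
      · induction a using Fin.cases with
        | zero => simp at ha
        | succ a =>
          simpa using hfirst a (by simpa using ha) fun c hca => by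
            simpa using hc c.succ (by simpa using hca)
    · have hx1 : x = 1 ∨ x = -1 := by
        have := h 0
        simp only [Fin.cons_zero] at this
        omega
      refine ⟨x, hx1, fun c => ?_, fun a ha hc => ?_⟩
      · induction c using Fin.cases with
        | zero => exact Or.inr (prefixSum_cons_zero _ _)
        | succ c =>
          rw [prefixSum_cons_succ]
          by_cases hv : ∀ a, v a = 0
          · right
            simp [prefixSum, hv]
          · push Not at hv
            obtain ⟨a, ha, hmin⟩ : ∃ a, v a ≠ 0 ∧ ∀ c < a, v c = 0 := by
              have hne : (univ.filter fun a => v a ≠ 0).Nonempty := by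
                obtain ⟨a, ha⟩ := hv
                exact ⟨a, by simpa using ha⟩
              refine ⟨_, (Finset.mem_filter.1 (Finset.min'_mem _ hne)).2, fun c hc => ?_⟩
              by_contra h'
              exact absurd (Finset.min'_le _ c (by simpa using h')) (not_le.2 hc)
            have e1 := hfirst a ha hmin
            have e2 : x = -v a := by
              simpa using halt 0 a.succ (Fin.succ_pos a) (by simpa using hx) (by simpa using ha)
                fun c h0c hca => by
                  induction c using Fin.cases with
                  | zero => simp at h0c
                  | succ c => simpa using hmin c (by simpa using hca)
            have := hpre c
            omega
      · induction a using Fin.cases with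
        | zero => simp
        | succ a => exact absurd (hc 0 (Fin.succ_pos a)) (by simpa using hx)

theorem prefixSum_last {n : ℕ} (v : Fin (n + 1) → ℤ) : prefixSum v (Fin.last n) = ∑ a, v a := by
  simp [prefixSum, Fin.le_last]

theorem isAlternatingSignVector_iff {n : ℕ} {v : Fin n → ℤ} :
    IsAlternatingSignVector v ↔ PrefixBounded v ∧ ∑ a, v a = 1 := by
  refine ⟨fun ⟨h1, h2, h3⟩ => ⟨?_, h2⟩, fun h => isAlternatingSignVector_of_prefixBounded h.1 h.2⟩
  obtain ⟨ε, hε, hpre, -⟩ := exists_sign_of_alternating v h1 h3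
  rcases n with _ | n
  · exact fun c => c.elim0
  · have := hpre (Fin.last n)
    rw [prefixSum_last, h2] at this
    have : ε = 1 := by omega
    subst this
    exact hpre

theorem isAlternatingSignVector_rev {n : ℕ} {v : Fin n → ℤ} (h : IsAlternatingSignVector v) :
    IsAlternatingSignVector fun a => v a.rev := by
  refine ⟨fun a => h.1 _, ?_, fun a b hab ha hb hc => ?_⟩
  · rw [← h.2.1]
    exact Equiv.sum_comp Fin.revPerm v
  · have := h.2.2 b.rev a.rev (Fin.rev_lt_rev.2 hab) hb ha fun c h1 h2 => by
      have := hc c.rev (by rwa [← Fin.rev_lt_rev, Fin.rev_rev]) (by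
        rwa [← Fin.rev_lt_rev, Fin.rev_rev])
      simpa only [Fin.rev_rev] using this
    simp only [this, neg_neg]

/-- The sum of the entries of `v` from the position `c` on. -/
def suffixSum {n : ℕ} (v : Fin n → ℤ) (c : Fin n) : ℤ := ∑ a, if c ≤ a then v a else 0

theorem suffixSum_cons_zero {n : ℕ} (x : ℤ) (v : Fin n → ℤ) :
    suffixSum (Fin.cons x v : Fin (n + 1) → ℤ) 0 = x + ∑ a, v a := by
  simp [suffixSum, Fin.sum_univ_succ]

theorem suffixSum_cons_succ {n : ℕ} (x : ℤ) (v : Fin n → ℤ) (c : Fin n) :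
    suffixSum (Fin.cons x v : Fin (n + 1) → ℤ) c.succ = suffixSum v c := by
  simp [suffixSum, Fin.sum_univ_succ]

theorem suffixSum_eq {n : ℕ} (v : Fin n → ℤ) (c : Fin n) :
    suffixSum v c = prefixSum (fun a => v a.rev) c.rev := by
  rw [suffixSum, prefixSum, ← Equiv.sum_comp Fin.revPerm]
  refine sum_congr rfl fun a _ => ?_
  simp only [Fin.revPerm_apply]
  congr 1
  rw [← Fin.rev_le_rev, Fin.rev_rev]

theorem isAlternatingSignVector_iff_suffix {n : ℕ} {v : Fin n → ℤ} :
    IsAlternatingSignVector v ↔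
      (∀ c, suffixSum v c = 0 ∨ suffixSum v c = 1) ∧ ∑ a, v a = 1 := by
  have hs : ∑ a : Fin n, v a.rev = ∑ a, v a := Equiv.sum_comp Fin.revPerm v
  constructor
  · intro h
    obtain ⟨h1, -⟩ := isAlternatingSignVector_iff.1 (isAlternatingSignVector_rev h)
    exact ⟨fun c => by rw [suffixSum_eq]; exact h1 _, h.2.1⟩
  · rintro ⟨h1, h2⟩
    have : IsAlternatingSignVector fun a => v a.rev := isAlternatingSignVector_iff.2
      ⟨fun c => by simpa [suffixSum_eq] using h1 c.rev, hs.trans h2⟩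
    simpa using isAlternatingSignVector_rev this

/-! ### The homogeneous partition function as a number of chains -/

/-- The number of paths, `0` or `1`, on an edge with the given state. -/
def bit (b : Bool) : ℤ := if b then 1 else 0

/-- The state `t` may follow above the state `s`: their difference is the row of an alternating sign
matrix. -/
def RowStep {n : ℕ} (s t : Fin n → Bool) : Prop :=
  IsAlternatingSignVector fun c => bit (s c) - bit (t c)

open Classical in
/-- At the homogeneous point, a row has weight `1` or `0`: the states of its horizontal edges are
determined from left to right as prefix sums of the difference of `s` and `t`. -/
theorem rowWeight_unit {n : ℕ} (h k : Bool) (s t : Fin n → Bool) :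
    rowWeight unitParam (fun _ => unitParam) h k s t =
      if (∀ c, bit h + prefixSum (fun c => bit (s c) - bit (t c)) c = 0 ∨
          bit h + prefixSum (fun c => bit (s c) - bit (t c)) c = 1) ∧
        bit h + ∑ c, (bit (s c) - bit (t c)) = bit k then 1 else 0 := by
  induction n generalizing h with
  | zero => cases h <;> cases k <;> simp [rowWeight, bit]
  | succ n ih =>
    induction s using Fin.consCases with
    | _ a s =>
    induction t using Fin.consCases with
    | _ b t =>
    have hc : (fun c => bit ((Fin.cons a s : Fin (n + 1) → Bool) c) -
        bit ((Fin.cons b t : Fin (n + 1) → Bool) c)) =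
        Fin.cons (bit a - bit b) fun c => bit (s c) - bit (t c) := by
      funext c
      refine Fin.cases ?_ (fun c => ?_) c <;> simp
    simp only [rowWeight, Fin.cons_zero, Fin.tail_cons, tail_unitParam, ih, Fintype.sum_bool]
    rw [hc]
    simp only [Fin.sum_univ_succ, Fin.forall_fin_succ, prefixSum_cons_zero, prefixSum_cons_succ,
      Fin.cons_zero, Fin.cons_succ]
    cases h <;> cases a <;> cases b <;>
      norm_num [vertexWeight, weightA, weightB, normForm, unitParam, bit, ← add_assoc]

theorem rowWeight_unit_eq {n : ℕ} (s t : Fin n → Bool) [Decidable (RowStep s t)] :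
    rowWeight unitParam (fun _ => unitParam) false true s t = if RowStep s t then 1 else 0 := by
  classical
  rw [rowWeight_unit]
  congr 1
  simp [RowStep, isAlternatingSignVector_iff, PrefixBounded, bit]

open Classical in
/-- The number of chains of `k` steps from the state `s` to the empty state. -/
noncomputable def chainNumber {n : ℕ} : ℕ → (Fin n → Bool) → ℕ
  | 0, s => if s = fun _ => false then 1 else 0
  | k + 1, s => ∑ t, if RowStep s t then chainNumber k t else 0

theorem chainCount_eq (n k : ℕ) (s : Fin n → Bool) : chainCount n k s = chainNumber k s := by
  classical
  induction k generalizing s with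
  | zero =>
    simp only [chainCount, List.replicate_zero, partition, chainNumber]
    split_ifs <;> simp
  | succ k ih =>
    simp only [chainCount, List.replicate_succ, partition, chainNumber]
    push_cast
    refine sum_congr rfl fun t _ => ?_
    rw [rowWeight_unit_eq, ← ih]
    simp [chainCount]

/-! ### Monotone triangles as chains -/

/-- Triangular integer arrays with `m` rows. -/
abbrev TriArray (m : ℕ) : Type := (i : Fin m) → Fin (i.val + 1) → ℤ

/-- The last row of a triangular array, as a function on `Fin m` for every `m`. -/
def TriArray.bottom {m : ℕ} (t : TriArray m) : Fin m → ℤ := fun j =>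
  t ⟨m - 1, by have := j.2; omega⟩ ⟨j, by have := j.2; simp only; omega⟩

/-- The triangular array without its last row. -/
def TriArray.init {m : ℕ} (t : TriArray (m + 1)) : TriArray m := fun i => t i.castSucc

/-- The triangular array extended by a last row `k`. -/
def TriArray.snoc {m : ℕ} (t : TriArray m) (k : Fin (m + 1) → ℤ) : TriArray (m + 1) :=
  Fin.snoc (α := fun i : Fin (m + 1) => Fin (i.val + 1) → ℤ) t k

theorem TriArray.init_snoc {m : ℕ} (t : TriArray m) (k : Fin (m + 1) → ℤ) :
    (t.snoc k).init = t := Fin.init_snoc (α := fun i : Fin (m + 1) => Fin (i.val + 1) → ℤ) k t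

theorem TriArray.bottom_eq {m : ℕ} (t : TriArray (m + 1)) : t.bottom = t (Fin.last m) := rfl

theorem TriArray.bottom_snoc {m : ℕ} (t : TriArray m) (k : Fin (m + 1) → ℤ) :
    (t.snoc k).bottom = k := by
  rw [TriArray.bottom_eq]
  exact Fin.snoc_last (α := fun i : Fin (m + 1) => Fin (i.val + 1) → ℤ) k t

theorem TriArray.snoc_init_bottom {m : ℕ} (t : TriArray (m + 1)) :
    t.init.snoc t.bottom = t :=
  Fin.snoc_init_self (α := fun i : Fin (m + 1) => Fin (i.val + 1) → ℤ) t

theorem hasBottomRow_iff {m : ℕ} (t : TriArray m) (k : Fin m → ℤ) :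
    HasBottomRow t k ↔ t.bottom = k := by
  constructor
  · intro h
    funext j
    exact h ⟨m - 1, by have := j.2; omega⟩ (by have := j.2; simp only; omega)
      ⟨j, by have := j.2; simp only; omega⟩
  · rintro rfl i h j
    obtain ⟨i, hi⟩ := i
    simp only at h
    subst h
    rfl

theorem strictMono_bottom {m : ℕ} {t : TriArray m} (h : IsMonotoneTriangle t) :
    StrictMono t.bottom := by
  intro a b hab
  exact h.1 ⟨m - 1, by have := a.2; omega⟩ hab

/-- The row `l` interlaces weakly with the longer row `k` below it. -/
def Interlace {m : ℕ} (k : Fin (m + 1) → ℤ) (l : Fin m → ℤ) : Prop :=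
  ∀ j : Fin m, k j.castSucc ≤ l j ∧ l j ≤ k j.succ

theorem isMonotoneTriangle_succ {m : ℕ} (t : TriArray (m + 1)) :
    IsMonotoneTriangle t ↔
      IsMonotoneTriangle t.init ∧ StrictMono t.bottom ∧ Interlace t.bottom t.init.bottom := by
  constructor
  · rintro ⟨h1, h2⟩
    refine ⟨⟨fun i => h1 i.castSucc, fun i hi j => h2 i (by omega) j⟩, h1 (Fin.last m), ?_⟩
    intro j
    obtain ⟨m, rfl⟩ : ∃ p, m = p + 1 := ⟨m - 1, by have := j.2; omega⟩
    exact h2 m (by omega) j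
  · rintro ⟨⟨h1, h2⟩, h3, h4⟩
    refine ⟨fun i => ?_, fun i hi j => ?_⟩
    · induction i using Fin.lastCases with
      | last => exact h3
      | cast i => exact h1 i
    · rcases Nat.lt_or_ge (i + 1) m with h | h
      · exact h2 i h j
      · obtain rfl : m = i + 1 := by omega
        exact h4 j

/-- The strictly increasing sequence `k` lists the set of columns of the state `s`; column
`c : Fin n` stands for the integer `c + 1`. -/
def Enumerates {m n : ℕ} (k : Fin m → ℤ) (s : Fin n → Bool) : Prop :=
  StrictMono k ∧ ∀ z : ℤ, (∃ j, k j = z) ↔ ∃ c : Fin n, s c = true ∧ z = c + 1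

theorem Enumerates.unique {m n : ℕ} {k l : Fin m → ℤ} {s : Fin n → Bool} (hk : Enumerates k s)
    (hl : Enumerates l s) : k = l := by
  rw [← hk.1.range_inj hl.1]
  ext z
  rw [Set.mem_range, Set.mem_range, hk.2, hl.2]

theorem Enumerates.card_filter {m n : ℕ} {k : Fin m → ℤ} {s : Fin n → Bool} (hk : Enumerates k s)
    (p : ℤ → Prop) [DecidablePred p] :
    ((univ.filter fun j => p (k j)).card : ℤ) =
      ∑ c : Fin n, if p (c + 1) then bit (s c) else 0 := by
  have h1 : ∑ c : Fin n, (if p (c + 1) then bit (s c) else 0) =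
      ((univ.filter fun c : Fin n => p (c + 1) ∧ s c = true).card : ℤ) := by
    rw [Finset.card_filter]
    push_cast
    refine sum_congr rfl fun c _ => ?_
    by_cases hp : p (c + 1) <;> by_cases hc : s c = true <;> simp [hp, hc, bit]
  rw [h1]
  congr 1
  have hinj : Function.Injective fun c : Fin n => (c : ℤ) + 1 := fun a b h => by
    simpa [Fin.ext_iff] using h
  rw [← Finset.card_image_of_injective (univ.filter fun j => p (k j)) hk.1.injective,
    ← Finset.card_image_of_injective (univ.filter fun c : Fin n => _) hinj]
  congr 1
  ext z
  simp only [Finset.mem_image, Finset.mem_filter, Finset.mem_univ, true_and]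
  constructor
  · rintro ⟨j, hj, rfl⟩
    obtain ⟨c, hc, hz⟩ := (hk.2 _).1 ⟨j, rfl⟩
    exact ⟨c, ⟨hz ▸ hj, hc⟩, hz.symm⟩
  · rintro ⟨c, ⟨hp, hc⟩, rfl⟩
    obtain ⟨j, hj⟩ := (hk.2 (c + 1)).2 ⟨c, hc, rfl⟩
    exact ⟨j, by rwa [hj], hj⟩

theorem Enumerates.sum_eq {m n : ℕ} {k : Fin m → ℤ} {s : Fin n → Bool} (hk : Enumerates k s) :
    ∑ c, bit (s c) = m := by
  have := hk.card_filter fun _ => True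
  simpa using this.symm

/-- For a strictly increasing sequence, comparing an entry with `z` amounts to counting the entries
up to `z`. -/
theorem card_le_iff {m : ℕ} {k : Fin m → ℤ} (hk : StrictMono k) (z : ℤ) (b : Fin m) :
    (b : ℕ) + 1 ≤ (univ.filter fun j => k j ≤ z).card ↔ k b ≤ z := by
  constructor
  · intro h
    by_contra hlt
    rw [not_le] at hlt
    have hsub : (univ.filter fun j => k j ≤ z) ⊆ Finset.Iio b := fun j hj => by
      rw [Finset.mem_Iio]
      exact hk.lt_iff_lt.1 ((Finset.mem_filter.1 hj).2.trans_lt hlt)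
    have := card_le_card hsub
    rw [Fin.card_Iio] at this
    omega
  · intro h
    have hsub : Finset.Iic b ⊆ univ.filter fun j => k j ≤ z := fun j hj => by
      rw [Finset.mem_filter]
      exact ⟨mem_univ _, (hk.monotone (Finset.mem_Iic.1 hj)).trans h⟩
    have := card_le_card hsub
    rwa [Fin.card_Iic] at this

/-- The prefix sums of the difference of the indicator vectors of `k` and `l` are
`#{k ≤ z} - #{l ≤ z}`, and both conditions say that these numbers are `0` or `1`. -/
theorem rowStep_iff_interlace {m n : ℕ} {k : Fin (m + 1) → ℤ} {l : Fin m → ℤ}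
    {s t : Fin n → Bool} (hk : Enumerates k s) (hl : Enumerates l t) :
    RowStep s t ↔ Interlace k l := by
  have hpre : ∀ c, prefixSum (fun c => bit (s c) - bit (t c)) c =
      (univ.filter fun j => k j ≤ c + 1).card - (univ.filter fun j => l j ≤ c + 1).card := by
    intro c
    rw [hk.card_filter fun z => z ≤ c + 1, hl.card_filter fun z => z ≤ c + 1,
      ← Finset.sum_sub_distrib, prefixSum]
    refine sum_congr rfl fun a _ => ?_
    by_cases h : a ≤ c
    · have h' : ((a : ℕ) : ℤ) + 1 ≤ (c : ℕ) + 1 := by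
        have : (a : ℕ) ≤ c := h
        omega
      simp [h, h']
    · have h' : ¬ ((a : ℕ) : ℤ) + 1 ≤ (c : ℕ) + 1 := by
        have : ¬ (a : ℕ) ≤ c := h
        omega
      simp [h]
  have hcol : ∀ z, (∃ j, k j = z) ∨ (∃ j, l j = z) → ∃ c : Fin n, z = c + 1 := by
    rintro z (h | h)
    · obtain ⟨c, -, hc⟩ := (hk.2 z).1 h
      exact ⟨c, hc⟩
    · obtain ⟨c, -, hc⟩ := (hl.2 z).1 h
      exact ⟨c, hc⟩
  have htot : ∑ c, (bit (s c) - bit (t c)) = 1 := by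
    rw [Finset.sum_sub_distrib, hk.sum_eq, hl.sum_eq]
    push_cast
    ring
  rw [RowStep, isAlternatingSignVector_iff, and_iff_left htot]
  constructor
  · intro h j
    constructor
    · obtain ⟨c, hc⟩ := hcol (l j) (Or.inr ⟨j, rfl⟩)
      have h1 := (card_le_iff hl.1 (l j) j).2 le_rfl
      have h2 := h c
      rw [hpre, ← hc] at h2
      refine (card_le_iff hk.1 (l j) j.castSucc).1 ?_
      simp only [Fin.val_castSucc]
      omega
    · obtain ⟨c, hc⟩ := hcol (k j.succ) (Or.inl ⟨_, rfl⟩)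
      have h1 := (card_le_iff hk.1 (k j.succ) j.succ).2 le_rfl
      have h2 := h c
      rw [hpre, ← hc] at h2
      refine (card_le_iff hl.1 (k j.succ) j).1 ?_
      simp only [Fin.val_succ] at h1
      omega
  · intro h c
    rw [hpre]
    set z : ℤ := (c : ℕ) + 1
    set Nk := (univ.filter fun j => k j ≤ z).card with hNk
    set Nl := (univ.filter fun j => l j ≤ z).card with hNl
    have hk1 : Nk ≤ m + 1 := by simpa using card_le_univ (univ.filter fun j => k j ≤ z)
    have hl1 : Nl ≤ m := by simpa using card_le_univ (univ.filter fun j => l j ≤ z)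
    have e1 : Nl ≤ Nk := by
      by_contra hlt
      rw [not_le] at hlt
      have h1 := (card_le_iff hl.1 z ⟨Nl - 1, by omega⟩).1 (by simp only; omega)
      have h2 := (card_le_iff hk.1 z _).2 ((h ⟨Nl - 1, by omega⟩).1.trans h1)
      simp only [Fin.castSucc_mk] at h2
      omega
    have e2 : Nk ≤ Nl + 1 := by
      by_contra hlt
      rw [not_le] at hlt
      have h1 := (card_le_iff hk.1 z (Fin.succ ⟨Nk - 2, by omega⟩)).1 (by
        simp only [Fin.succ_mk]; omega)
      have h2 := (card_le_iff hl.1 z _).2 ((h ⟨Nk - 2, by omega⟩).2.trans h1)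
      simp only at h2
      omega
    omega

theorem exists_enumerates {m n : ℕ} (s : Fin n → Bool) (hs : ∑ c, bit (s c) = m) :
    ∃ k : Fin m → ℤ, Enumerates k s := by
  set S : Finset ℤ := (univ.filter fun c => s c = true).image fun c : Fin n => (c : ℤ) + 1
    with hS
  have hinj : Function.Injective fun c : Fin n => (c : ℤ) + 1 := fun a b h => by
    simpa [Fin.ext_iff] using h
  have hcard : S.card = m := by
    rw [hS, Finset.card_image_of_injective _ hinj, Finset.card_filter]
    have : ((∑ c, if s c = true then 1 else 0 : ℕ) : ℤ) = m := by
      rw [← hs]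
      push_cast
      rfl
    exact_mod_cast this
  refine ⟨S.orderEmbOfFin hcard, (S.orderEmbOfFin hcard).strictMono, fun z => ?_⟩
  have : (∃ j, S.orderEmbOfFin hcard j = z) ↔ z ∈ S := by
    rw [← Finset.mem_coe, ← Finset.range_orderEmbOfFin S hcard]
    rfl
  rw [this, hS]
  simp only [Finset.mem_image, Finset.mem_filter, Finset.mem_univ, true_and]
  exact exists_congr fun c => and_congr_right fun _ => eq_comm

/-- The state that occupies the columns `c` for which `c + 1` is an entry of `l`. -/
noncomputable def stateOf {m : ℕ} (n : ℕ) (l : Fin m → ℤ) : Fin n → Bool := by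
  classical
  exact fun c => decide (∃ j, l j = c + 1)

theorem enumerates_stateOf {m n : ℕ} {k : Fin (m + 1) → ℤ} {l : Fin m → ℤ} {s : Fin n → Bool}
    (hk : Enumerates k s) (hl : StrictMono l) (h : Interlace k l) :
    Enumerates l (stateOf n l) := by
  refine ⟨hl, fun z => ⟨?_, ?_⟩⟩
  · rintro ⟨j, rfl⟩
    obtain ⟨a, -, ha⟩ := (hk.2 _).1 ⟨j.castSucc, rfl⟩
    obtain ⟨b, -, hb⟩ := (hk.2 _).1 ⟨j.succ, rfl⟩
    have h1 := (h j).1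
    have h2 := (h j).2
    have h3 := b.2
    have hc : l j = ((⟨(l j - 1).toNat, by omega⟩ : Fin n) : ℕ) + 1 := by
      simp only
      omega
    refine ⟨⟨(l j - 1).toNat, by omega⟩, ?_, hc⟩
    simp only [stateOf, decide_eq_true_eq]
    exact ⟨j, hc⟩
  · rintro ⟨c, hc, rfl⟩
    simpa [stateOf] using hc

theorem Enumerates.eq_stateOf {m n : ℕ} {l : Fin m → ℤ} {s : Fin n → Bool} (h : Enumerates l s) :
    stateOf n l = s := by
  funext c
  have := h.2 (c + 1)
  rw [Bool.eq_iff_iff]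
  simp only [stateOf, decide_eq_true_eq]
  rw [this]
  constructor
  · rintro ⟨d, hd, hcd⟩
    have : c = d := Fin.ext (by omega)
    rwa [this]
  · exact fun hc => ⟨c, hc, rfl⟩

/-- The monotone triangles of order `m` whose last row lists the columns of the state `s`. -/
abbrev TrianglesOver (m : ℕ) {n : ℕ} (s : Fin n → Bool) : Type :=
  {t : TriArray m // IsMonotoneTriangle t ∧ Enumerates t.bottom s}

theorem RowStep.sum_eq {n m : ℕ} {s t : Fin n → Bool} (h : RowStep s t)
    (hs : ∑ c, bit (s c) = (m + 1 : ℕ)) : ∑ c, bit (t c) = m := by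
  have := h.2.1
  rw [Finset.sum_sub_distrib, hs] at this
  push_cast at this
  omega

/-- A monotone triangle of order `m + 1` consists of its last row, which `s` determines, and of a
monotone triangle over a state that may follow above `s`. -/
noncomputable def trianglesOverSucc {m n : ℕ} (s : Fin n → Bool) {k : Fin (m + 1) → ℤ}
    (hk : Enumerates k s) :
    TrianglesOver (m + 1) s ≃ Σ t : {t : Fin n → Bool // RowStep s t}, TrianglesOver m t.1 where
  toFun t :=
    have ht := (isMonotoneTriangle_succ t.1).1 t.2.1
    have he := enumerates_stateOf t.2.2 (strictMono_bottom ht.1) ht.2.2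
    ⟨⟨stateOf n t.1.init.bottom, (rowStep_iff_interlace t.2.2 he).2 ht.2.2⟩,
      ⟨t.1.init, ht.1, he⟩⟩
  invFun p := ⟨p.2.1.snoc k, by
    rw [isMonotoneTriangle_succ, TriArray.init_snoc, TriArray.bottom_snoc]
    exact ⟨p.2.2.1, hk.1, (rowStep_iff_interlace hk p.2.2.2).1 p.1.2⟩, by
    rwa [TriArray.bottom_snoc]⟩
  left_inv t := by
    apply Subtype.ext
    simp only
    rw [← t.2.2.unique hk, TriArray.snoc_init_bottom]
  right_inv := by
    rintro ⟨⟨t, ht⟩, ⟨a, ha, he⟩⟩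
    have h1 : stateOf n (a.snoc k).init.bottom = t := by
      rw [TriArray.init_snoc]
      exact he.eq_stateOf
    subst h1
    simp only [TriArray.init_snoc]

theorem card_trianglesOver {n : ℕ} (m : ℕ) (s : Fin n → Bool) (hs : ∑ c, bit (s c) = m) :
    Finite (TrianglesOver m s) ∧ Nat.card (TrianglesOver m s) = chainNumber m s := by
  classical
  induction m generalizing s with
  | zero =>
    have hs0 : s = fun _ => false := by
      have := (Finset.sum_eq_zero_iff_of_nonneg (fun c _ => by
        simp only [bit]; split_ifs <;> norm_num)).1 hs
      funext c
      have := this c (mem_univ c)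
      simpa [bit] using this
    have : Unique (TrianglesOver 0 s) :=
      { default := ⟨fun i => i.elim0, ⟨fun i => i.elim0, fun i hi => by omega⟩,
          fun i => i.elim0, fun z => by simp [hs0]⟩
        uniq := fun t => Subtype.ext (funext fun i => i.elim0) }
    exact ⟨inferInstance, by rw [Nat.card_unique, chainNumber, if_pos hs0]⟩
  | succ m ih =>
    obtain ⟨k, hk⟩ := exists_enumerates s hs
    have hfin : ∀ t : {t : Fin n → Bool // RowStep s t}, Finite (TrianglesOver m t.1) :=
      fun t => (ih t.1 (t.2.sum_eq hs)).1
    have e := trianglesOverSucc s hk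
    refine ⟨Finite.of_equiv _ e.symm, ?_⟩
    rw [Nat.card_congr e, Nat.card_sigma, chainNumber, ← Finset.sum_filter]
    rw [Finset.sum_congr rfl fun (t : {t : Fin n → Bool // RowStep s t}) _ =>
      (ih t.1 (t.2.sum_eq hs)).2]
    rw [← Finset.sum_subtype_eq_sum_filter]
    simp

theorem monotoneTriangleCountOfSet_eq {n m : ℕ} {S : Finset ℤ} {s : Fin n → Bool}
    (hS : ∀ z : ℤ, z ∈ S ↔ ∃ c : Fin n, s c = true ∧ z = c + 1) (hm : S.card = m) :
    monotoneTriangleCountOfSet S = chainNumber m s := by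
  subst hm
  have he : Enumerates (S.orderEmbOfFin rfl) s := by
    refine ⟨(S.orderEmbOfFin rfl).strictMono, fun z => ?_⟩
    rw [← hS, ← Finset.mem_coe, ← Finset.range_orderEmbOfFin S rfl]
    rfl
  rw [← (card_trianglesOver S.card s he.sum_eq).2, monotoneTriangleCountOfSet,
    monotoneTriangleCount]
  refine Nat.card_congr (Equiv.subtypeEquivRight fun t => and_congr_right fun _ => ?_)
  rw [hasBottomRow_iff t]
  exact ⟨fun h => h ▸ he, fun h => h.unique he⟩

/-! ### Alternating sign matrices as chains -/

/-- The rows of `M` are alternating sign vectors, the partial column sums of `M` taken from the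
bottom are `0` or `1`, and the full column sums of `M` are given by the state `s`. These are the
last `k` rows of alternating sign matrices of order `n`. -/
def IsPartialASM {k n : ℕ} (s : Fin n → Bool) (M : Fin k → Fin n → ℤ) : Prop :=
  (∀ r, IsAlternatingSignVector (M r)) ∧
  ∀ c, (∀ r, suffixSum (fun r => M r c) r = 0 ∨ suffixSum (fun r => M r c) r = 1) ∧
    ∑ r, M r c = bit (s c)

theorem bit_injective : Function.Injective bit := by
  intro a b h
  cases a <;> cases b <;> simp_all [bit]

theorem bit_eq_zero_or_one (b : Bool) : bit b = 0 ∨ bit b = 1 := by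
  cases b <;> simp [bit]

theorem exists_bit_eq_sum {k : ℕ} {v : Fin k → ℤ}
    (h : ∀ r, suffixSum v r = 0 ∨ suffixSum v r = 1) : ∃ b, bit b = ∑ r, v r := by
  suffices ∑ r, v r = 0 ∨ ∑ r, v r = 1 by
    rcases this with h | h <;> rw [h]
    · exact ⟨false, rfl⟩
    · exact ⟨true, rfl⟩
  rcases k with _ | k
  · simp
  · simpa [suffixSum] using h 0

/-- The state `t` over which the remaining rows lie is given by their column sums. -/
theorem isPartialASM_cons {k n : ℕ} {s : Fin n → Bool} {x : Fin n → ℤ}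
    {M : Fin k → Fin n → ℤ} :
    IsPartialASM s (Fin.cons x M : Fin (k + 1) → Fin n → ℤ) ↔
      IsAlternatingSignVector x ∧ ∃ t, IsPartialASM t M ∧ ∀ c, x c = bit (s c) - bit (t c) := by
  have hcol : ∀ c, (fun r => (Fin.cons x M : Fin (k + 1) → Fin n → ℤ) r c) =
      (Fin.cons (x c) fun r => M r c : Fin (k + 1) → ℤ) := fun c => by
    funext r
    refine Fin.cases ?_ (fun r => ?_) r <;> simp
  simp only [IsPartialASM, hcol, Fin.forall_fin_succ, suffixSum_cons_zero, suffixSum_cons_succ,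
    Fin.cons_zero, Fin.cons_succ, Fin.sum_univ_succ]
  constructor
  · rintro ⟨⟨hx, hM⟩, h⟩
    choose t ht using fun c => exists_bit_eq_sum (h c).1.2
    refine ⟨hx, t, ⟨hM, fun c => ⟨(h c).1.2, (ht c).symm⟩⟩, fun c => ?_⟩
    rw [ht, ← (h c).2]
    ring
  · rintro ⟨hx, t, ⟨hM, ht⟩, hxt⟩
    refine ⟨⟨hx, hM⟩, fun c => ?_⟩
    rw [(ht c).2, hxt, sub_add_cancel]
    exact ⟨⟨bit_eq_zero_or_one _, (ht c).1⟩, rfl⟩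

theorem IsPartialASM.unique {k n : ℕ} {s t : Fin n → Bool} {M : Fin k → Fin n → ℤ}
    (hs : IsPartialASM s M) (ht : IsPartialASM t M) : s = t :=
  funext fun c => bit_injective ((hs.2 c).2.symm.trans (ht.2 c).2)

theorem card_partialASM {n : ℕ} (k : ℕ) (s : Fin n → Bool) :
    Finite {M : Fin k → Fin n → ℤ // IsPartialASM s M} ∧
      Nat.card {M : Fin k → Fin n → ℤ // IsPartialASM s M} = chainNumber k s := by
  classical
  induction k generalizing s with
  | zero =>
    have hiff : ∀ M : Fin 0 → Fin n → ℤ, IsPartialASM s M ↔ s = fun _ => false := fun M => by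
      have h0 : ∀ c, 0 = bit (s c) ↔ s c = false := fun c => by cases s c <;> simp [bit]
      simp [IsPartialASM, funext_iff, h0]
    refine ⟨inferInstance, ?_⟩
    rw [chainNumber]
    split_ifs with h
    · have : Unique {M : Fin 0 → Fin n → ℤ // IsPartialASM s M} :=
        { default := ⟨fun i => i.elim0, (hiff _).2 h⟩
          uniq := fun M => Subtype.ext (funext fun i => i.elim0) }
      exact Nat.card_unique
    · have : IsEmpty {M : Fin 0 → Fin n → ℤ // IsPartialASM s M} :=
        ⟨fun M => h ((hiff M.1).1 M.2)⟩
      exact Nat.card_of_isEmpty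
  | succ k ih =>
    have hfin : ∀ t : {t : Fin n → Bool // RowStep s t},
        Finite {M : Fin k → Fin n → ℤ // IsPartialASM t.1 M} := fun t => (ih t.1).1
    let f : (Σ t : {t : Fin n → Bool // RowStep s t},
        {M : Fin k → Fin n → ℤ // IsPartialASM t.1 M}) →
        {M : Fin (k + 1) → Fin n → ℤ // IsPartialASM s M} := fun p =>
      ⟨Fin.cons (fun c => bit (s c) - bit (p.1.1 c)) p.2.1,
        isPartialASM_cons.2 ⟨p.1.2, p.1.1, p.2.2, fun _ => rfl⟩⟩
    have hf : Function.Bijective f := by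
      constructor
      · rintro ⟨⟨t, ht⟩, ⟨M, hM⟩⟩ ⟨⟨t', ht'⟩, ⟨M', hM'⟩⟩ h
        obtain rfl : M = M' :=
          congrArg (Fin.tail (α := fun _ => Fin n → ℤ)) (congrArg Subtype.val h)
        obtain rfl := hM.unique hM'
        rfl
      · rintro ⟨M, hM⟩
        induction M using Fin.consCases with
        | _ x M =>
        obtain ⟨hx, t, ht, hxt⟩ := isPartialASM_cons.1 hM
        obtain rfl : x = fun c => bit (s c) - bit (t c) := funext hxt
        exact ⟨⟨⟨t, hx⟩, ⟨M, ht⟩⟩, rfl⟩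
    have e := Equiv.ofBijective f hf
    refine ⟨Finite.of_equiv _ e, ?_⟩
    rw [← Nat.card_congr e, Nat.card_sigma, chainNumber, ← Finset.sum_filter]
    rw [Finset.sum_congr rfl fun (t : {t : Fin n → Bool // RowStep s t}) _ => (ih t.1).2]
    rw [← Finset.sum_subtype_eq_sum_filter]
    simp

theorem isAlternatingSignMatrix_iff {n : ℕ} (M : Matrix (Fin n) (Fin n) ℤ) :
    IsAlternatingSignMatrix M ↔ IsPartialASM (fun _ => true) M := by
  simp only [IsAlternatingSignMatrix, IsPartialASM, isAlternatingSignVector_iff_suffix, bit,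
    if_true]

theorem prefixSum_unitRow {n k : ℕ} (hk : 1 ≤ k) (hkn : k ≤ n) (c : Fin n) :
    prefixSum (unitRow n k) c = if k ≤ c + 1 then 1 else 0 := by
  rw [prefixSum, Finset.sum_eq_single ⟨k - 1, by omega⟩]
  · have h1 : unitRow n k ⟨k - 1, by omega⟩ = 1 := if_pos (by simp only; omega)
    rw [h1]
    congr 1
    rw [Fin.le_def]
    simp only [eq_iff_iff]
    omega
  · intro a _ ha
    have h1 : unitRow n k a = 0 := if_neg fun h => ha (Fin.ext (by simp only; omega))
    simp [h1]
  · simp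

theorem sum_unitRow {n k : ℕ} (hk : 1 ≤ k) (hkn : k ≤ n) : ∑ c, unitRow n k c = 1 := by
  obtain ⟨n, rfl⟩ : ∃ m, n = m + 1 := ⟨n - 1, by omega⟩
  rw [← prefixSum_last, prefixSum_unitRow hk hkn, if_pos (by simpa using hkn)]

theorem isAlternatingSignVector_unitRow {n k : ℕ} (hk : 1 ≤ k) (hkn : k ≤ n) :
    IsAlternatingSignVector (unitRow n k) := by
  refine isAlternatingSignVector_iff.2 ⟨fun c => ?_, sum_unitRow hk hkn⟩
  rw [prefixSum_unitRow hk hkn]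
  split_ifs <;> simp

theorem isAlternatingSignVector_add_sub {n i j k : ℕ} (hi : 1 ≤ i) (hik : i ≤ k) (hkj : k ≤ j)
    (hj : j ≤ n) : IsAlternatingSignVector (unitRow n i + unitRow n j - unitRow n k) := by
  refine isAlternatingSignVector_iff.2 ⟨fun c => ?_, ?_⟩
  · have : prefixSum (unitRow n i + unitRow n j - unitRow n k) c =
        prefixSum (unitRow n i) c + prefixSum (unitRow n j) c - prefixSum (unitRow n k) c := by
      simp only [prefixSum, ← Finset.sum_add_distrib, ← Finset.sum_sub_distrib]
      refine sum_congr rfl fun a _ => ?_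
      split_ifs <;> simp
    rw [this, prefixSum_unitRow hi (by omega), prefixSum_unitRow (by omega) hj,
      prefixSum_unitRow (by omega) (by omega)]
    split_ifs <;> omega
  · simp only [Pi.add_apply, Pi.sub_apply, Finset.sum_add_distrib, Finset.sum_sub_distrib]
    rw [sum_unitRow hi (by omega), sum_unitRow (by omega) hj, sum_unitRow (by omega) (by omega)]
    norm_num

theorem bit_fullExcept {n k : ℕ} (hk : 1 ≤ k) (hkn : k ≤ n) (c : Fin n) :
    bit (fullExcept (⟨k - 1, by omega⟩ : Fin n) c) = 1 - unitRow n k c := by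
  have : c = ⟨k - 1, by omega⟩ ↔ (c : ℕ) + 1 = k := by
    rw [Fin.ext_iff]
    simp only
    omega
  by_cases h : (c : ℕ) + 1 = k <;> simp [fullExcept, Function.update_apply, unitRow, bit, this, h]

theorem bit_fullExceptTwo {n i j : ℕ} (hi : 1 ≤ i) (hij : i < j) (hj : j ≤ n) (c : Fin n) :
    bit (fullExceptTwo (⟨i - 1, by omega⟩ : Fin n) ⟨j - 1, by omega⟩ c) =
      1 - unitRow n i c - unitRow n j c := by
  have h1 : c = ⟨i - 1, by omega⟩ ↔ (c : ℕ) + 1 = i := by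
    rw [Fin.ext_iff]
    simp only
    omega
  have h2 : c = ⟨j - 1, by omega⟩ ↔ (c : ℕ) + 1 = j := by
    rw [Fin.ext_iff]
    simp only
    omega
  simp only [fullExceptTwo, Function.update_apply, unitRow, bit, h1, h2]
  split_ifs <;> first | omega | simp_all

/-- The rows below the first two form a partial matrix over `(1, …, 1) - e_i - e_j`; the row `e_k`
leads from the full state to `fullExcept` of `k`, and the second row leads on from there. -/
theorem asmCountTopTwoRows_eq {m i j k : ℕ} (hi : 1 ≤ i) (hij : i < j) (hj : j ≤ m + 2)
    (hik : i ≤ k) (hkj : k ≤ j) :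
    asmCountTopTwoRows (m + 2) (unitRow (m + 2) k)
        (unitRow (m + 2) i + unitRow (m + 2) j - unitRow (m + 2) k) =
      chainNumber m (fullExceptTwo (⟨i - 1, by omega⟩ : Fin (m + 2)) ⟨j - 1, by omega⟩) := by
  set u := unitRow (m + 2) k with hu
  set v := unitRow (m + 2) i + unitRow (m + 2) j - unitRow (m + 2) k with hv
  rw [← (card_partialASM m _).2, asmCountTopTwoRows]
  symm
  have hiff : ∀ M : Fin m → Fin (m + 2) → ℤ,
      IsPartialASM (fun _ => true) (Fin.cons u (Fin.cons v M : Fin (m + 1) → Fin (m + 2) → ℤ) :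
        Fin (m + 2) → Fin (m + 2) → ℤ) ↔
      IsPartialASM (fullExceptTwo (⟨i - 1, by omega⟩ : Fin (m + 2)) ⟨j - 1, by omega⟩) M := by
    intro M
    rw [isPartialASM_cons]
    simp only [isPartialASM_cons]
    constructor
    · rintro ⟨-, t, ⟨-, t', hM, hv'⟩, hu'⟩
      convert hM using 1
      funext c
      apply bit_injective
      rw [bit_fullExceptTwo hi hij hj]
      have h1 := hv' c
      have h2 := hu' c
      simp only [hv, hu, Pi.add_apply, Pi.sub_apply, bit, if_true] at h1 h2 ⊢
      linarith
    · intro hM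
      refine ⟨isAlternatingSignVector_unitRow (by omega) (by omega),
        fullExcept ⟨k - 1, by omega⟩, ⟨isAlternatingSignVector_add_sub hi hik hkj hj, _, hM,
          fun c => ?_⟩, fun c => ?_⟩
      · rw [bit_fullExceptTwo hi hij hj, bit_fullExcept (by omega) (by omega)]
        simp only [hv, Pi.add_apply, Pi.sub_apply]
        ring
      · rw [bit_fullExcept (by omega) (by omega)]
        simp [bit, hu]
  let f : {M : Fin m → Fin (m + 2) → ℤ //
        IsPartialASM (fullExceptTwo (⟨i - 1, by omega⟩ : Fin (m + 2)) ⟨j - 1, by omega⟩) M} →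
      {M : Matrix (Fin (m + 2)) (Fin (m + 2)) ℤ // IsAlternatingSignMatrix M ∧
        (∀ r : Fin (m + 2), r.val = 0 → ∀ c, M r c = u c) ∧
          ∀ r : Fin (m + 2), r.val = 1 → ∀ c, M r c = v c} := fun M =>
    ⟨(Fin.cons u (Fin.cons v M.1 : Fin (m + 1) → Fin (m + 2) → ℤ) :
        Fin (m + 2) → Fin (m + 2) → ℤ),
      (isAlternatingSignMatrix_iff _).2 ((hiff M.1).2 M.2), fun r hr c => by
        obtain rfl : r = 0 := Fin.ext hr
        rfl, fun r hr c => by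
        obtain rfl : r = Fin.succ 0 := Fin.ext hr
        rfl⟩
  refine Nat.card_congr (Equiv.ofBijective f ⟨fun M M' h => ?_, ?_⟩)
  · exact Subtype.ext (congrArg (fun N : Fin (m + 2) → Fin (m + 2) → ℤ => fun r : Fin m =>
      N r.succ.succ) (congrArg Subtype.val h))
  · rintro ⟨M, hM, h0, h1⟩
    have hM' : (Fin.cons u (Fin.cons v fun r => M r.succ.succ :
        Fin (m + 1) → Fin (m + 2) → ℤ) : Fin (m + 2) → Fin (m + 2) → ℤ) = M := by
      funext r
      refine Fin.cases ?_ (fun r => Fin.cases ?_ (fun r => ?_) r) r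
      · exact (funext (h0 0 rfl)).symm
      · exact (funext (h1 (Fin.succ 0) rfl)).symm
      · rfl
    refine ⟨⟨fun r => M r.succ.succ, (hiff _).1 ?_⟩, Subtype.ext hM'⟩
    rw [hM']
    exact (isAlternatingSignMatrix_iff M).1 hM

/-! ### The numbers of the theorem as numbers of chains -/

theorem mem_Icc_iff_exists {n : ℕ} (z : ℤ) :
    z ∈ Finset.Icc 1 (n : ℤ) ↔ ∃ c : Fin n, z = c + 1 := by
  rw [Finset.mem_Icc]
  constructor
  · intro h
    exact ⟨⟨(z - 1).toNat, by omega⟩, by simp only; omega⟩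
  · rintro ⟨c, rfl⟩
    have := c.2
    omega

theorem asmNumber_eq (n : ℕ) : asmNumber n = chainNumber n fun _ : Fin n => true :=
  monotoneTriangleCountOfSet_eq (fun z => by rw [mem_Icc_iff_exists]; simp) (by simp)

theorem refinedAsmNumber_eq (n k : ℕ) : (refinedAsmNumber n k : ℝ) = refinedCount n k := by
  rw [refinedAsmNumber, refinedCount]
  split_ifs with h
  · rw [chainCount_eq, monotoneTriangleCountOfSet_eq]
    · intro z
      rw [Finset.mem_erase, mem_Icc_iff_exists]
      constructor
      · rintro ⟨hz, c, rfl⟩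
        refine ⟨c, ?_, rfl⟩
        rw [fullExcept, Function.update_apply, if_neg fun hc => hz ?_]
        rw [hc]
        simp only
        omega
      · rintro ⟨c, hc, rfl⟩
        refine ⟨fun hz => ?_, c, rfl⟩
        have : c = ⟨k - 1, by omega⟩ := Fin.ext (by simp only; omega)
        simp [this, fullExcept] at hc
    · rw [Finset.card_erase_of_mem (by rw [Finset.mem_Icc]; omega)]
      simp
  · simp

theorem doublyRefinedAsmNumber_eq_chainNumber {n i j : ℕ} (hi : 1 ≤ i) (hij : i < j)
    (hj : j ≤ n) : doublyRefinedAsmNumber n i j =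
      chainNumber (n - 2) (fullExceptTwo (⟨i - 1, by omega⟩ : Fin n) ⟨j - 1, by omega⟩) := by
  rw [doublyRefinedAsmNumber]
  refine monotoneTriangleCountOfSet_eq (fun z => ?_) ?_
  · rw [Finset.mem_erase, Finset.mem_erase, mem_Icc_iff_exists]
    constructor
    · rintro ⟨hzj, hzi, c, rfl⟩
      refine ⟨c, ?_, rfl⟩
      apply bit_injective
      rw [bit_fullExceptTwo hi hij hj, unitRow, unitRow, if_neg (by omega), if_neg (by omega)]
      rfl
    · rintro ⟨c, hc, rfl⟩
      have := bit_fullExceptTwo hi hij hj c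
      rw [hc] at this
      simp only [unitRow, bit, if_true] at this
      refine ⟨fun hz => ?_, fun hz => ?_, c, rfl⟩
      · split_ifs at this <;> omega
      · split_ifs at this <;> omega
  · rw [Finset.card_erase_of_mem (by rw [Finset.mem_erase, Finset.mem_Icc]; omega),
      Finset.card_erase_of_mem (by rw [Finset.mem_Icc]; omega)]
    simp
    omega

theorem asmX_eq {m s r : ℕ} (hsr : s < r) (hr : r ≤ m + 2) :
    (asmX (m + 2) s r : ℝ) = doublyRefinedCount (m + 2) s r -
      doublyRefinedCount (m + 2) s (r + 1) + doublyRefinedCount (m + 2) (s + 1) (r + 1) := by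
  have hpos := chainCount_full_pos (m + 1)
  have hα : ((asmNumber (m + 1) : ℕ) : ℝ) = chainCount (m + 1) (m + 1) fun _ => true := by
    rw [asmNumber_eq, chainCount_eq]
  have key := doublyRefinedCount_recursion m s r hsr hr
  simp only [asmX, Nat.add_succ_sub_one]
  push_cast
  rw [hα]
  simp only [refinedAsmNumber_eq]
  rw [← key]
  field_simp

end

theorem theorem1 (n i j : ℕ) (hi : 1 ≤ i) (hij : i < j) (hj : j ≤ n) :
    (doublyRefinedAsmNumber n i j : ℚ) =
        ∑ p ∈ Finset.range (n - j + 1), ∑ q ∈ Finset.range (p + 1),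
          (-1 : ℚ) ^ q * (p.choose q : ℚ) * asmX n (i + q) (j + p) ∧
      ∀ k : ℕ, i ≤ k → k ≤ j →
        asmCountTopTwoRows n (unitRow n k) (unitRow n i + unitRow n j - unitRow n k) =
          doublyRefinedAsmNumber n i j := by
  obtain ⟨m, rfl⟩ : ∃ m, n = m + 2 := ⟨n - 2, by omega⟩
  refine ⟨?_, fun k hik hkj => ?_⟩
  · -- the recursion needs the value `0` outside of `1 ≤ a < b ≤ n`, where the number of the theorem
    -- counts something else
    set A : ℕ → ℕ → ℚ := fun a b =>
      if 1 ≤ a ∧ a < b ∧ b ≤ m + 2 then (doublyRefinedAsmNumber (m + 2) a b : ℚ) else 0 with hA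
    have hAc : ∀ a b, (A a b : ℝ) = doublyRefinedCount (m + 2) a b := by
      intro a b
      rw [hA, doublyRefinedCount]
      simp only
      split_ifs with h
      · rw [chainCount_eq, doublyRefinedAsmNumber_eq_chainNumber h.1 h.2.1 h.2.2]
        push_cast
        rfl
      · simp
    have hAij : A i j = doublyRefinedAsmNumber (m + 2) i j := if_pos ⟨hi, hij, hj⟩
    rw [← hAij]
    refine (sum_choose_eq hj A _ (fun a b h => if_neg (by omega)) (fun a b _ hab hb => ?_)
      hij).symm
    have := asmX_eq hab hb
    rw [← hAc, ← hAc, ← hAc] at this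
    exact_mod_cast this
  · rw [asmCountTopTwoRows_eq hi hij hj hik hkj, doublyRefinedAsmNumber_eq_chainNumber hi hij hj]
    rfl
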